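/- On the unit sphere $S^2\subset\mathbb R^3$ with the spherical distance, a hemisphere is a closed ball of radius $\pi/2$. For non-antipodal points $a,b$ the arc $ab$ is the shorter closed great-circle arc joining them. A set is convex if it contains no pair of antipodes and contains, with any two of its points, the arc joining them; a convex body is a closed convex set with non-empty interior. A hemisphere $K$ supports a convex body $C$ if $C\subset K$ and the great circle $\mathrm{bd}(K)$ contains a boundary point of $C$. If $G,H$ are hemispheres that are neither equal nor opposite, then $G\cap H$ is called a lune; the two semicircles bounding it are $G/H\subset\mathrm{bd}(G)$ and $H/G\subset\mathrm{bd}(H)$, and the thickness of $G\cap H$ is the distance between the centers of these two semicircles. For a supporting hemisphere $K$ of $C$, let $\mathrm{width}_K(C)$ be the minimum thickness of a lune $K\cap K'$ over hemispheres $K'$ supporting $C$, and let $K^*$ denote a hemisphere $K'$ attaining this minimum. The thickness $\Delta(C)$ is the minimum of $\mathrm{width}_K(C)$ over all supporting hemispheres $K$ of $C$. A convex body $R$ is reduced if $\Delta(Z)<\Delta(R)$ for every convex body $Z\subset R$ with $Z\neq R$. **Theorem.** Let $R\subset S^2$ be a reduced convex body with $\Delta(R)<\frac{\pi}{2}$,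 and let $M$ be a supporting hemisphere of $R$ such that the intersection of $\mathrm{bd}(M)$ with $\mathrm{bd}(R)$ is a non-degenerate arc $x_1x_2$ (that is, $x_1\ne x_2$). Then $\mathrm{width}_M(R)=\Delta(R)$; moreover a hemisphere $M^*$ exists, and for every such $M^*$ the center of the semicircle $M/M^*$ belongs to the arc $x_1x_2$. -/

import Mathlib

namespace Sph

noncomputable section

/-- The unit sphere `S²` of Euclidean three-space, with its subspace topology. The antipode of
`x` is `-x`. -/
abbrev S2 : Type := Metric.sphere (0 : EuclideanSpace ℝ (Fin 3)) 1

/-- Inner product of two points of the sphere, taken in the ambient space. -/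
def ip (x y : S2) : ℝ :=
  inner ℝ (x : EuclideanSpace ℝ (Fin 3)) (y : EuclideanSpace ℝ (Fin 3))

/-- Spherical distance: the length of the shorter great-circle arc from `x` to `y`. -/
def sdist (x y : S2) : ℝ :=
  InnerProductGeometry.angle (x : EuclideanSpace ℝ (Fin 3)) (y : EuclideanSpace ℝ (Fin 3))

/-- The hemisphere `H(m)` with center `m`: the points at spherical distance at most `π / 2`
from `m`. -/
def hemisphere (m : S2) : Set S2 := {x | 0 ≤ ip m x}

/-- The great circle bounding the hemisphere `H(m)`. -/
def greatCircle (m : S2) : Set S2 := {x | ip m x = 0}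

theorem mem_hemisphere_iff (m x : S2) : x ∈ hemisphere m ↔ sdist m x ≤ Real.pi / 2 := by
  rw [sdist, InnerProductGeometry.angle, Real.arccos_le_pi_div_two]
  simp [hemisphere, ip]

/-- The arc `ab`, for points `a` and `b` that are not antipodes: the points of the sphere in the
convex cone spanned by `a` and `b`. It contains its end-points. -/
def arc (a b : S2) : Set S2 :=
  {x | ∃ s t : ℝ, 0 ≤ s ∧ 0 ≤ t ∧ (x : EuclideanSpace ℝ (Fin 3)) =
    s • (a : EuclideanSpace ℝ (Fin 3)) + t • (b : EuclideanSpace ℝ (Fin 3))}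

/-- A set is (spherically) convex if it contains no pair of antipodes and contains with any two
points the arc connecting them. -/
def IsConvex (C : Set S2) : Prop :=
  (∀ x ∈ C, -x ∉ C) ∧ ∀ a ∈ C, ∀ b ∈ C, arc a b ⊆ C

/-- A spherical convex body: a closed convex set with non-empty interior. -/
structure IsConvexBody (C : Set S2) : Prop where
  isClosed : IsClosed C
  isConvex : IsConvex C
  interior_nonempty : (interior C).Nonempty

/-- The hemisphere `H(k)` supports `C`: it contains `C`, and some boundary point of `C` lies on
the great circle bounding `H(k)`. -/
def Supports (k : S2) (C : Set S2) : Prop :=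
  C ⊆ hemisphere k ∧ ∃ p ∈ frontier C, p ∈ greatCircle k

/-- The hemispheres `H(g)` and `H(h)` are different and not opposite, so that
`H(g) ∩ H(h)` is a lune. -/
def FormLune (g h : S2) : Prop := h ≠ g ∧ h ≠ -g

/-- The semicircle `G/H`, for `G = H(g)` and `H = H(h)`: of the two semicircles bounding the lune
`G ∩ H`, the one contained in the boundary of `G`. -/
def semicircle (g h : S2) : Set S2 := greatCircle g ∩ hemisphere h

/-- The component of `h` orthogonal to `g`. -/
def centerDir (g h : S2) : EuclideanSpace ℝ (Fin 3) :=
  (h : EuclideanSpace ℝ (Fin 3)) - ip g h • (g : EuclideanSpace ℝ (Fin 3))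

theorem centerDir_ne_zero {g h : S2} (hgh : FormLune g h) : centerDir g h ≠ 0 := by
  intro h0
  have e : (h : EuclideanSpace ℝ (Fin 3)) = ip g h • (g : EuclideanSpace ℝ (Fin 3)) :=
    sub_eq_zero.mp h0
  have hg : ‖(g : EuclideanSpace ℝ (Fin 3))‖ = 1 := by simp
  have hh : ‖(h : EuclideanSpace ℝ (Fin 3))‖ = 1 := by simp
  have hn : |ip g h| = 1 := by
    have := congrArg norm e
    rw [norm_smul, hg, hh, Real.norm_eq_abs, mul_one] at this
    exact this.symm
  rcases (abs_eq zero_le_one).mp hn with h1 | h1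
  · exact hgh.1 (Subtype.ext (by rw [e, h1, one_smul]))
  · exact hgh.2 (Subtype.ext (by rw [e, h1]; simp))

open Classical in
/-- The center of the semicircle `H(g)/H(h)`, for `H(g) ∩ H(h)` a lune: the normalized component
of `h` orthogonal to `g` (see `semicircle_eq`). If `H(g) ∩ H(h)` is not a lune, the value is
irrelevant. -/
def semicircleCenter (g h : S2) : S2 :=
  if hv : centerDir g h = 0 then g
  else ⟨‖centerDir g h‖⁻¹ • centerDir g h, by
    rw [mem_sphere_zero_iff_norm, norm_smul, norm_inv, norm_norm,
      inv_mul_cancel₀ (norm_ne_zero_iff.mpr hv)]⟩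

/-- The center of the semicircle lies on the great circle of the semicircle. -/
theorem semicircleCenter_mem {g h : S2} (hgh : FormLune g h) :
    semicircleCenter g h ∈ greatCircle g := by
  have hg : ‖(g : EuclideanSpace ℝ (Fin 3))‖ = 1 := by simp
  have hv := centerDir_ne_zero hgh
  simp only [greatCircle, Set.mem_ofPred_eq, ip, semicircleCenter, hv, dite_false,
    inner_smul_right]
  simp [centerDir, inner_sub_right, inner_smul_right, ip, hg]

/-- The semicircle consists of the points of its great circle at distance at most `π / 2` from
its center. -/
theorem semicircle_eq {g h : S2} (hgh : FormLune g h) :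
    semicircle g h = {x ∈ greatCircle g | sdist (semicircleCenter g h) x ≤ Real.pi / 2} := by
  have hv := centerDir_ne_zero hgh
  ext x
  simp only [semicircle, Set.mem_inter_iff, Set.mem_ofPred_eq]
  refine and_congr_right fun hx => ?_
  rw [← mem_hemisphere_iff]
  have hx' : inner ℝ (g : EuclideanSpace ℝ (Fin 3)) (x : EuclideanSpace ℝ (Fin 3)) = 0 := hx
  have key : ip (semicircleCenter g h) x = ‖centerDir g h‖⁻¹ * ip h x := by
    simp only [ip, semicircleCenter, hv, dite_false, real_inner_smul_left]
    rw [centerDir, inner_sub_left, real_inner_smul_left, hx', mul_zero, sub_zero]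
  have hpos : 0 < ‖centerDir g h‖⁻¹ := inv_pos.mpr (norm_pos_iff.mpr hv)
  simp only [hemisphere, Set.mem_ofPred_eq, key]
  exact (mul_nonneg_iff_of_pos_left hpos).symm

/-- The thickness of the lune `H(g) ∩ H(h)`: the distance of the centers of the two semicircles
bounding it. -/
def luneThickness (g h : S2) : ℝ := sdist (semicircleCenter g h) (semicircleCenter h g)

/-- `width_K(C)` for `K = H(k)`: the minimum thickness of a lune `K ∩ K'` over the hemispheres
`K'` supporting `C`. -/
def width (C : Set S2) (k : S2) : ℝ :=
  sInf {t | ∃ h : S2, Supports h C ∧ FormLune k h ∧ t = luneThickness k h}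

/-- `H(h)` is a hemisphere `K^*` for `K = H(k)`: it supports `C`, and the lune `K ∩ K^*` has the
minimum thickness among all lunes `K ∩ K'` with `K'` supporting `C`. -/
def IsStar (C : Set S2) (k h : S2) : Prop :=
  Supports h C ∧ FormLune k h ∧
    ∀ h' : S2, Supports h' C → FormLune k h' → luneThickness k h ≤ luneThickness k h'

/-- The thickness `Δ(C)`: the minimum of `width_K(C)` over all supporting hemispheres `K`. -/
def thickness (C : Set S2) : ℝ := sInf {t | ∃ k : S2, Supports k C ∧ t = width C k}

/-- A reduced body: a convex body all of whose proper convex sub-bodies have strictly smaller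
thickness. -/
def IsReduced (R : Set S2) : Prop :=
  IsConvexBody R ∧ ∀ Z : Set S2, IsConvexBody Z → Z ⊆ R → Z ≠ R → thickness Z < thickness R

end

end Sph

open Sph

/-! The argument takes place in the polar cone K = `polar R`, whose unit vectors are the centers of
the hemispheres containing R. A lune with centers g, h has thickness π − ∠(g, h)
(`luneThickness_eq`), so Δ(R) is π minus the largest angle in K. If c is the cosine of that angle,
Δ(R) < π/2 means c < 0. A pair consists of two unit vectors of K at the largest angle. A
non-degenerate arc of contact x₁x₂ makes m a vertex of K whose normals are the nonnegative
combinations of x₁ and x₂. Everything follows once m is known to belong to a pair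
(`IsVertex.exists_isPair`): for a pair m, m' the vector m' − c m is a normal of K at m, hence such a
combination, and it points to the center of M/M*.

Reducedness enters through `IsReduced.hasLimitPairs`. Cutting R by a hemisphere whose center lies
just outside K enlarges the polar cone and, by reducedness, its largest angle. As these centers tend
to z in K, the new extremal pairs tend to a pair u, v of K such that the supporting plane at u
orthogonal to the arc uv contains z.

Suppose that m belongs to no pair. Approaching m along each of its two edges gives pairs with one
end q on that edge and an arc orthogonal to it; take q nearest to m, with opposite end p. A boundary
vector z lying, as seen from m, between the two opposite ends so obtained yields a pair u, v whose
supporting plane at u contains z. The arcs of two different pairs are not opposite sides of a convex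
quadrangle, since its diagonals would be too long (`IsPair.no_quadrangle`). For the edge selected by
the orientation of u, v this forces the supporting plane at p to contain z as well. Then the edges
from p to z and from q to m leave the arc pq at right angles on opposite sides, and moving p and q
along them produces too large an angle (`IsPair.no_opposite_edges`). -/

open scoped RealInnerProductSpace

/-! ### Pairs at the largest angle of a cone, and determinant identities -/

namespace Sph

section Cone

variable {F : Type*} [NormedAddCommGroup F] [InnerProductSpace ℝ F]

/-- The unit vectors `u`, `v` of the cone `K` have inner product `c`. -/
structure IsPair (K : ProperCone ℝ F) (c : ℝ) (u v : F) : Prop where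
  left_mem : u ∈ K
  right_mem : v ∈ K
  norm_left : ‖u‖ = 1
  norm_right : ‖v‖ = 1
  inner_eq : ⟪u, v⟫ = c

/-- Any two vectors of the cone `K` include an angle with cosine at least `c`. -/
def CosBound (K : ProperCone ℝ F) (c : ℝ) : Prop :=
  ∀ u ∈ K, ∀ v ∈ K, c * (‖u‖ * ‖v‖) ≤ ⟪u, v⟫

theorem smul_mem_cone {K : ProperCone ℝ F} {a : ℝ} (ha : 0 ≤ a) {x : F} (hx : x ∈ K) :
    a • x ∈ K :=
  K.smul_mem hx ha

theorem IsPair.symm {K : ProperCone ℝ F} {c : ℝ} {u v : F} (h : IsPair K c u v) :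
    IsPair K c v u :=
  ⟨h.right_mem, h.left_mem, h.norm_right, h.norm_left, by rw [real_inner_comm]; exact h.inner_eq⟩

theorem norm_add_smul_le {y d : F} (hy : ‖y‖ = 1) (t : ℝ) :
    ‖y + t • d‖ ≤ 1 + t * ⟪y, d⟫ + t ^ 2 * ‖d‖ ^ 2 / 2 := by
  have h : ‖y + t • d‖ ^ 2 = 1 + 2 * (t * ⟪y, d⟫) + t ^ 2 * ‖d‖ ^ 2 := by
    rw [norm_add_sq_real, norm_smul, real_inner_smul_right, hy, mul_pow, Real.norm_eq_abs, sq_abs]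
    ring
  nlinarith [sq_nonneg (‖y + t • d‖ - 1)]

theorem le_norm_add_smul {y d : F} (hy : ‖y‖ = 1) (t : ℝ) :
    1 + t * ⟪y, d⟫ ≤ ‖y + t • d‖ := by
  have h := real_inner_le_norm y (y + t • d)
  rw [inner_add_right, real_inner_smul_right, real_inner_self_eq_norm_sq, hy] at h
  linarith

/-- First-order condition at a unit vector of `K` farthest from `k`. -/
theorem inner_sub_smul_nonneg {K : ProperCone ℝ F} {k y : F} {c : ℝ}
    (hmin : ∀ d ∈ K, c * ‖d‖ ≤ ⟪k, d⟫) (hyK : y ∈ K) (hy : ‖y‖ = 1) (hc : ⟪k, y⟫ = c)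
    {d : F} (hd : d ∈ K) : 0 ≤ ⟪k - c • y, d⟫ := by
  rw [inner_sub_left, real_inner_smul_left]
  set B : ℝ := |c| * (‖d‖ ^ 2 / 2) with hB
  have hB0 : 0 ≤ B := by positivity
  have key : ∀ t : ℝ, 0 < t → -(t * B) ≤ ⟪k, d⟫ - c * ⟪y, d⟫ := by
    intro t ht
    have h := hmin (y + t • d) (K.add_mem hyK (smul_mem_cone ht.le hd))
    rw [inner_add_right, real_inner_smul_right, hc] at h
    -- The sign of c is arbitrary here, so the norm is needed from both sides, up to a second-order
    -- error.
    have h1 : c * (1 + t * ⟪y, d⟫) - t ^ 2 * B ≤ c * ‖y + t • d‖ := by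
      have e1 := norm_add_smul_le (d := d) hy t
      have e2 := le_norm_add_smul (d := d) hy t
      have e3 : |c * (‖y + t • d‖ - (1 + t * ⟪y, d⟫))| ≤ |c| * (t ^ 2 * ‖d‖ ^ 2 / 2) := by
        rw [abs_mul]
        gcongr
        rw [abs_of_nonneg (by linarith)]
        linarith
      have e4 := (abs_le.mp e3).1
      rw [hB]
      linarith
    by_contra hlt
    push Not at hlt
    nlinarith
  by_contra hneg
  push Not at hneg
  -- For this t the error t * B is at most half of the supposed negative gap.
  have h := key ((-(⟪k, d⟫ - c * ⟪y, d⟫)) / (2 * (B + 1))) (by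
    apply div_pos <;> linarith)
  have h2 : (-(⟪k, d⟫ - c * ⟪y, d⟫)) / (2 * (B + 1)) * B ≤ (-(⟪k, d⟫ - c * ⟪y, d⟫)) / 2 := by
    rw [div_mul_eq_mul_div, div_le_div_iff₀ (by linarith) (by norm_num)]
    nlinarith
  linarith

/-- Each end of a pair is farthest from the other, so the plane through u orthogonal to the arc uv
supports the cone. -/
theorem IsPair.normal_nonneg {K : ProperCone ℝ F} {c : ℝ} (hb : CosBound K c) {u v : F}
    (h : IsPair K c u v) {d : F} (hd : d ∈ K) : 0 ≤ ⟪v - c • u, d⟫ := by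
  refine inner_sub_smul_nonneg (fun d hd => ?_) h.left_mem h.norm_left
    (by rw [real_inner_comm]; exact h.inner_eq) hd
  simpa [h.norm_right] using hb v h.right_mem d hd

theorem IsPair.inner_normal_left {K : ProperCone ℝ F} {c : ℝ} {u v : F} (h : IsPair K c u v) :
    ⟪v - c • u, u⟫ = 0 := by
  rw [inner_sub_left, real_inner_smul_left, real_inner_self_eq_norm_sq, h.norm_left,
    real_inner_comm, h.inner_eq]
  ring

theorem IsPair.inner_normal_right {K : ProperCone ℝ F} {c : ℝ} {u v : F} (h : IsPair K c u v) :
    ⟪v - c • u, v⟫ = 1 - c ^ 2 := by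
  rw [inner_sub_left, real_inner_smul_left, real_inner_self_eq_norm_sq, h.norm_right,
    h.inner_eq]
  ring

/-- As c < 0, the bound for u and v + v' forces ‖v + v'‖ ≥ 2, which leaves only equal unit vectors.
-/
theorem IsPair.right_unique {K : ProperCone ℝ F} {c : ℝ} (hb : CosBound K c) (hc : c < 0)
    {u v v' : F} (h : IsPair K c u v) (h' : IsPair K c u v') : v = v' := by
  have h1 := hb u h.left_mem (v + v') (K.add_mem h.right_mem h'.right_mem)
  rw [inner_add_right, h.inner_eq, h'.inner_eq, h.norm_left, one_mul] at h1
  have h2 : 2 ≤ ‖v + v'‖ := by nlinarith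
  have h3 : ‖v + v'‖ ^ 2 = 2 + 2 * ⟪v, v'⟫ := by
    rw [norm_add_sq_real, h.norm_right, h'.norm_right]; ring
  have h4 : ⟪v, v'⟫ ≤ 1 := by
    simpa [h.norm_right, h'.norm_right] using real_inner_le_norm v v'
  have h5 : 1 ≤ ⟪v, v'⟫ := by nlinarith
  exact (inner_eq_one_iff_of_norm_eq_one h.norm_right h'.norm_right).mp (le_antisymm h4 h5)

theorem angle_add_of_combination {x y z : F} {a b : ℝ} (ha : 0 ≤ a) (hb : 0 ≤ b)
    (h : y = a • x + b • z) (hy : y ≠ 0) :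
    InnerProductGeometry.angle x z =
      InnerProductGeometry.angle x y + InnerProductGeometry.angle y z := by
  refine InnerProductGeometry.angle_eq_angle_add_add_angle_add_of_mem_span hy ?_
  rw [Submodule.mem_span_pair]
  exact ⟨⟨a, ha⟩, ⟨b, hb⟩, h.symm⟩

/-- The arcs joining the points of two different pairs are not opposite sides of a convex
quadrangle. -/
theorem IsPair.no_quadrangle {K : ProperCone ℝ F} {c : ℝ} (hb : CosBound K c) (hc : c < 0)
    {p q u v o : F} (hpq : IsPair K c p q) (huv : IsPair K c u v) {α β γ l : ℝ}
    (hα : 0 ≤ α) (hβ : 0 ≤ β) (hγ : 0 ≤ γ) (hl : 0 ≤ l) (ho : o ≠ 0)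
    (h1 : o = α • p + β • v) (h2 : o = γ • u + l • q) : p = u := by
  -- The diagonals pv and uq meet at o, so by the triangle inequality their sum is at least that of
  -- pq and uv, twice the largest angle. Hence both diagonals attain the largest angle.
  have e1 := angle_add_of_combination hα hβ h1 ho
  have e2 := angle_add_of_combination hγ hl h2 ho
  have t1 := InnerProductGeometry.angle_le_angle_add_angle p o q
  have t2 := InnerProductGeometry.angle_le_angle_add_angle u o v
  have apq : InnerProductGeometry.angle p q = Real.arccos c := by
    simp [InnerProductGeometry.angle, hpq.norm_left, hpq.norm_right, hpq.inner_eq]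
  have auv : InnerProductGeometry.angle u v = Real.arccos c := by
    simp [InnerProductGeometry.angle, huv.norm_left, huv.norm_right, huv.inner_eq]
  have auq : InnerProductGeometry.angle u q ≤ Real.arccos c := by
    rw [InnerProductGeometry.angle, huv.norm_left, hpq.norm_right, mul_one, div_one]
    apply Real.arccos_le_arccos
    simpa [huv.norm_left, hpq.norm_right] using hb u huv.left_mem q hpq.right_mem
  have bpv : c ≤ ⟪p, v⟫ := by
    simpa [hpq.norm_left, huv.norm_right] using hb p hpq.left_mem v huv.right_mem
  have apv : InnerProductGeometry.angle p v = Real.arccos ⟪p, v⟫ := by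
    simp [InnerProductGeometry.angle, hpq.norm_left, huv.norm_right]
  have hle : Real.arccos ⟪p, v⟫ ≤ Real.arccos c := Real.arccos_le_arccos bpv
  have heq : Real.arccos ⟪p, v⟫ = Real.arccos c := by linarith
  have hpv : ⟪p, v⟫ = c := by
    have b1 := abs_le.mp (abs_real_inner_le_norm p v)
    have b2 := abs_le.mp (abs_real_inner_le_norm p q)
    rw [hpq.norm_left, huv.norm_right] at b1
    rw [hpq.norm_left, hpq.norm_right, hpq.inner_eq] at b2
    exact Real.arccos_injOn ⟨by linarith, by linarith⟩ ⟨by linarith, by linarith⟩ heq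
  have hvq : v = q := IsPair.right_unique hb hc
    ⟨hpq.left_mem, huv.right_mem, hpq.norm_left, huv.norm_right, hpv⟩ hpq
  subst hvq
  exact hpq.symm.right_unique hb hc huv.symm

/-- Orientation of `a`, `b` in the plane coordinates `⟪x₂, ·⟫`, `⟪x₁, ·⟫`. -/
def det₂ (x₁ x₂ a b : F) : ℝ := ⟪x₂, a⟫ * ⟪x₁, b⟫ - ⟪x₁, a⟫ * ⟪x₂, b⟫

/-- The determinant of `a`, `b`, `d` in the coordinates `⟪m, ·⟫`, `⟪x₂, ·⟫`, `⟪x₁, ·⟫`. -/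
def det₃ (x₁ x₂ m a b d : F) : ℝ :=
  det₂ x₁ x₂ b d * ⟪m, a⟫ + det₂ x₁ x₂ a b * ⟪m, d⟫ - det₂ x₁ x₂ a d * ⟪m, b⟫

/-- `x₁`, `x₂` and the unit vector `m` span the space, and `m` is orthogonal to `x₁`, `x₂`. -/
structure IsFrame (x₁ x₂ m : F) : Prop where
  norm_pole : ‖m‖ = 1
  inner_left : ⟪x₁, m⟫ = 0
  inner_right : ⟪x₂, m⟫ = 0
  eq_zero : ∀ a : F, ⟪x₁, a⟫ = 0 → ⟪x₂, a⟫ = 0 → ⟪m, a⟫ = 0 → a = 0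

namespace IsFrame

variable {x₁ x₂ m : F} (hf : IsFrame x₁ x₂ m)
include hf

theorem inner_self : ⟪m, m⟫ = 1 := by
  rw [real_inner_self_eq_norm_sq, hf.norm_pole]; norm_num

theorem swap : IsFrame x₂ x₁ m :=
  ⟨hf.norm_pole, hf.inner_right, hf.inner_left, fun a h1 h2 h3 => hf.eq_zero a h2 h1 h3⟩

theorem ext_inner {a b : F} (h1 : ⟪x₁, a⟫ = ⟪x₁, b⟫) (h2 : ⟪x₂, a⟫ = ⟪x₂, b⟫)
    (h3 : ⟪m, a⟫ = ⟪m, b⟫) : a = b := by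
  rw [← sub_eq_zero]
  apply hf.eq_zero <;> rw [inner_sub_right, sub_eq_zero] <;> assumption

/-- The linear dependence of a, b, d, m. Evaluating a supporting functional on it gives the sign of
the determinant. -/
theorem det₃_smul (a b d : F) :
    det₃ x₁ x₂ m a b d • m =
      det₂ x₁ x₂ b d • a + det₂ x₁ x₂ a b • d - det₂ x₁ x₂ a d • b := by
  apply hf.ext_inner <;>
  simp only [det₃, det₂, inner_add_right, inner_sub_right, real_inner_smul_right, hf.inner_self,
    hf.inner_left, hf.inner_right] <;> ring

/-- When the four coefficients are nonnegative, either side represents the common point of the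
diagonals pv and uq. -/
theorem quadrangle_relation (p u v q : F) :
    det₃ x₁ x₂ m u v q • p + det₃ x₁ x₂ m p u q • v =
      det₃ x₁ x₂ m p v q • u + det₃ x₁ x₂ m p u v • q := by
  apply hf.ext_inner <;>
  simp only [det₃, det₂, inner_add_right, real_inner_smul_right] <;> ring

theorem cramer (p q y : F) :
    det₂ x₁ x₂ p q • y =
      det₃ x₁ x₂ m y q m • p + det₃ x₁ x₂ m p y m • q + det₃ x₁ x₂ m p q y • m := by
  apply hf.ext_inner <;>
  simp only [det₃, det₂, inner_add_right, real_inner_smul_right, hf.inner_self,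
    hf.inner_left, hf.inner_right] <;> ring

end IsFrame

end Cone

end Sph

/-! ### Relative position of pairs near a vertex -/

namespace Sph

section Cone

variable {F : Type*} [NormedAddCommGroup F] [InnerProductSpace ℝ F]

/-- A cone cannot contain, at the two ends of a pair, arcs orthogonal to the arc of the pair that
leave it on opposite sides. -/
theorem IsPair.no_opposite_edges {K : ProperCone ℝ F} {c κ : ℝ} (hb : CosBound K c)
    (hc : -1 < c) {p q z m : F} (h : IsPair K c p q) (hz : z ∈ K) (hm : m ∈ K)
    (hpz : ⟪q - c • p, z⟫ = 0) (hne : z - ⟪p, z⟫ • p ≠ 0) (hκ : 0 < κ)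
    (hop : m - ⟪q, m⟫ • q = -κ • (z - ⟪p, z⟫ • p)) : False := by
  set n := z - ⟪p, z⟫ • p with hn
  have hpp : ⟪p, p⟫ = 1 := by rw [real_inner_self_eq_norm_sq, h.norm_left]; norm_num
  have hqq : ⟪q, q⟫ = 1 := by rw [real_inner_self_eq_norm_sq, h.norm_right]; norm_num
  have hpn : ⟪p, n⟫ = 0 := by
    rw [hn, inner_sub_right, real_inner_smul_right, hpp]; ring
  have hqn : ⟪q, n⟫ = 0 := by
    rw [inner_sub_left, real_inner_smul_left] at hpz
    rw [hn, inner_sub_right, real_inner_smul_right, real_inner_comm p q, h.inner_eq]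
    linarith
  have hnn : 0 < ⟪n, n⟫ := real_inner_self_pos.mpr hne
  -- With b = 1 / S and a = κ b, the vectors p + a n and q − a n are nonnegative combinations of p,
  -- z and of q, m, so both lie in K.
  set S : ℝ := 1 + |⟪q, m⟫| + κ * |⟪p, z⟫| with hS
  have hκz : 0 ≤ κ * |⟪p, z⟫| := by positivity
  have hS0 : 0 < S := by positivity
  set b : ℝ := 1 / S with hbdef
  have hb0 : 0 < b := by positivity
  have hbS : b * S = 1 := by rw [hbdef]; field_simp
  have b1 : b * ⟪q, m⟫ ≤ 1 := by
    have : ⟪q, m⟫ ≤ S := by have := le_abs_self ⟪q, m⟫; linarith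
    nlinarith
  have b2 : κ * b * ⟪p, z⟫ ≤ 1 := by
    have : κ * ⟪p, z⟫ ≤ S := by
      have h1 := mul_le_mul_of_nonneg_left (le_abs_self ⟪p, z⟫) hκ.le
      have := abs_nonneg ⟪q, m⟫
      linarith
    nlinarith
  set a : ℝ := κ * b with ha
  have ha0 : 0 < a := by positivity
  have hU : p + a • n ∈ K := by
    have : p + a • n = (1 - a * ⟪p, z⟫) • p + a • z := by rw [hn]; module
    rw [this]
    exact K.add_mem (smul_mem_cone (by linarith) h.left_mem) (smul_mem_cone ha0.le hz)
  have hV : q - a • n ∈ K := by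
    have : q - a • n = (1 - b * ⟪q, m⟫) • q + b • m := by
      have e : b • (m - ⟪q, m⟫ • q) = -(a • n) := by rw [hop, ha]; module
      rw [sub_eq_add_neg, ← e]; module
    rw [this]
    exact K.add_mem (smul_mem_cone (by linarith) h.right_mem) (smul_mem_cone hb0.le hm)
  have hnp : ⟪n, p⟫ = 0 := by rw [real_inner_comm]; exact hpn
  have hnq : ⟪n, q⟫ = 0 := by rw [real_inner_comm]; exact hqn
  have nU : ‖p + a • n‖ ^ 2 = 1 + a ^ 2 * ⟪n, n⟫ := by
    rw [← real_inner_self_eq_norm_sq]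
    simp only [inner_add_left, inner_add_right, real_inner_smul_left, real_inner_smul_right, hpp,
      hpn, hnp]
    ring
  have nV : ‖q - a • n‖ ^ 2 = 1 + a ^ 2 * ⟪n, n⟫ := by
    rw [← real_inner_self_eq_norm_sq]
    simp only [inner_sub_left, inner_sub_right, real_inner_smul_left, real_inner_smul_right, hqq,
      hqn, hnq]
    ring
  have e : ‖p + a • n‖ = ‖q - a • n‖ := by
    rw [← sq_eq_sq₀ (norm_nonneg _) (norm_nonneg _), nU, nV]
  -- Both vectors have squared norm 1 + a²‖n‖², while their inner product is c − a²‖n‖². This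
  -- violates the bound because c > −1.
  have key := hb _ hU _ hV
  rw [← e, ← sq, nU] at key
  simp only [inner_add_left, inner_sub_right, real_inner_smul_left, real_inner_smul_right,
    h.inner_eq, hpn, hnq] at key
  have : 0 < a ^ 2 * ⟪n, n⟫ := by positivity
  nlinarith

variable {x₁ x₂ m : F} {K : ProperCone ℝ F} {c : ℝ}

/-- The components of z orthogonal to p and of m orthogonal to q are both orthogonal to the plane of
p and q, hence parallel. Their determinants with p, q have opposite signs, so they point to opposite
sides. -/
theorem IsFrame.exists_opposite (hf : IsFrame x₁ x₂ m) {p q z : F} (h : IsPair K c p q)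
    (hpz : ⟪q - c • p, z⟫ = 0) (hqm : ⟪p - c • q, m⟫ = 0)
    (hD : 0 < det₂ x₁ x₂ p q) (hA : det₃ x₁ x₂ m p q z < 0) :
    z - ⟪p, z⟫ • p ≠ 0 ∧
      ∃ κ : ℝ, 0 < κ ∧ m - ⟪q, m⟫ • q = -κ • (z - ⟪p, z⟫ • p) := by
  set n := z - ⟪p, z⟫ • p with hn
  set n' := m - ⟪q, m⟫ • q with hn'
  set A := det₃ x₁ x₂ m p q z with hAdef
  set D := det₂ x₁ x₂ p q with hDdef
  have hpp : ⟪p, p⟫ = 1 := by rw [real_inner_self_eq_norm_sq, h.norm_left]; norm_num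
  have hqq : ⟪q, q⟫ = 1 := by rw [real_inner_self_eq_norm_sq, h.norm_right]; norm_num
  have hqp : ⟪q, p⟫ = c := by rw [real_inner_comm]; exact h.inner_eq
  rw [inner_sub_left, real_inner_smul_left] at hpz hqm
  have hAn : det₃ x₁ x₂ m p q n = A := by
    rw [hAdef, hn]
    simp only [det₃, det₂, inner_sub_right, real_inner_smul_right]; ring
  have hAn' : det₃ x₁ x₂ m p q n' = D := by
    rw [hDdef, hn']
    simp only [det₃, det₂, inner_sub_right, real_inner_smul_right, hf.inner_self,
      hf.inner_left, hf.inner_right]; ring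
  refine ⟨fun h0 => ?_, -(D / A), ?_, ?_⟩
  · rw [h0] at hAn
    simp [det₃, det₂] at hAn
    linarith
  · exact neg_pos.mpr (div_neg_of_pos_of_neg hD hA)
  · set y := A • n' - D • n with hy
    have hdy : det₃ x₁ x₂ m p q y = 0 := by
      have : det₃ x₁ x₂ m p q y = A * det₃ x₁ x₂ m p q n' - D * det₃ x₁ x₂ m p q n := by
        rw [hy]
        simp only [det₃, det₂, inner_sub_right, real_inner_smul_right]; ring
      rw [this, hAn, hAn']; ring
    have hcr := hf.cramer p q y
    rw [hdy, zero_smul, add_zero] at hcr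
    have hpy : ⟪y, p⟫ = 0 := by
      rw [real_inner_comm, hy, hn, hn']
      simp only [inner_sub_right, real_inner_smul_right, hpp, h.inner_eq]
      linear_combination A * hqm
    have hqy : ⟪y, q⟫ = 0 := by
      rw [real_inner_comm, hy, hn, hn']
      simp only [inner_sub_right, real_inner_smul_right, hqq, hqp]
      linear_combination -D * hpz
    have hyy : D * ⟪y, y⟫ = 0 := by
      rw [← real_inner_smul_right, hcr, inner_add_right, real_inner_smul_right,
        real_inner_smul_right, hpy, hqy]
      ring
    have hy0 : y = 0 := by
      rcases mul_eq_zero.mp hyy with h1 | h1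
      · linarith
      · exact inner_self_eq_zero.mp h1
    rw [hy, sub_eq_zero] at hy0
    rw [neg_neg, div_eq_inv_mul, mul_smul, ← hy0, smul_smul, inv_mul_cancel₀ hA.ne, one_smul]

/-- `m` is a vertex of the cone `K`: the functionals that are nonnegative on `K` and vanish at
`m` are the nonnegative combinations of the unit vectors `x₁`, `x₂`. -/
structure IsVertex (K : ProperCone ℝ F) (x₁ x₂ m : F) : Prop where
  frame : IsFrame x₁ x₂ m
  mem : m ∈ K
  norm_left : ‖x₁‖ = 1
  norm_right : ‖x₂‖ = 1
  left_nonneg : ∀ d ∈ K, 0 ≤ ⟪x₁, d⟫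
  right_nonneg : ∀ d ∈ K, 0 ≤ ⟪x₂, d⟫
  normal : ∀ w : F, (∀ d ∈ K, 0 ≤ ⟪w, d⟫) → ⟪w, m⟫ = 0 →
    ∃ α β : ℝ, 0 ≤ α ∧ 0 ≤ β ∧ w = α • x₁ + β • x₂

theorem IsVertex.swap (h : IsVertex K x₁ x₂ m) : IsVertex K x₂ x₁ m where
  frame := h.frame.swap
  mem := h.mem
  norm_left := h.norm_right
  norm_right := h.norm_left
  left_nonneg := h.right_nonneg
  right_nonneg := h.left_nonneg
  normal w hw hwm := by
    obtain ⟨α, β, hα, hβ, e⟩ := h.normal w hw hwm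
    exact ⟨β, α, hβ, hα, by rw [e, add_comm]⟩

/-- `q` is the point nearest to `m` on the edge orthogonal to `x₂` that forms a pair with its
opposite point `c • q + √(1 - c ^ 2) • x₂`. -/
structure IsNearest (K : ProperCone ℝ F) (c : ℝ) (x₁ x₂ m q : F) : Prop where
  pair : IsPair K c (c • q + √(1 - c ^ 2) • x₂) q
  inner_right : ⟪x₂, q⟫ = 0
  inner_left : 0 < ⟪x₁, q⟫
  nearest : ∀ v : F, IsPair K c (c • v + √(1 - c ^ 2) • x₂) v → ⟪x₂, v⟫ = 0 →
    ⟪m, v⟫ * ⟪x₁, q⟫ ≤ ⟪m, q⟫ * ⟪x₁, v⟫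

theorem IsPair.sq_norm_normal {u v : F} (h : IsPair K c u v) : ‖v - c • u‖ ^ 2 = 1 - c ^ 2 := by
  rw [← real_inner_self_eq_norm_sq]
  have h1 := h.inner_normal_left
  have h2 := h.inner_normal_right
  rw [inner_sub_right, real_inner_smul_right, h1, h2]; ring

/-- Seen from m, the cone lies in a quadrant, where orientation orders the directions. Strictness in
`h2` excludes multiples of m as the middle vector, which would be comparable with everything. -/
theorem det₂_trans (hv : IsVertex K x₁ x₂ m) {a b d : F} (ha : a ∈ K) (hb : b ∈ K) (hd : d ∈ K)
    (h1 : 0 ≤ det₂ x₁ x₂ a b) (h2 : 0 < det₂ x₁ x₂ b d) : 0 ≤ det₂ x₁ x₂ a d := by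
  have xa := hv.left_nonneg a ha
  have ya := hv.right_nonneg a ha
  have xb := hv.left_nonneg b hb
  have yb := hv.right_nonneg b hb
  have xd := hv.left_nonneg d hd
  have yd := hv.right_nonneg d hd
  have hY : 0 < ⟪x₂, b⟫ := by
    by_contra hn
    have h0 : ⟪x₂, b⟫ = 0 := by linarith
    rw [det₂, h0] at h2
    nlinarith [mul_nonneg xb yd]
  have e : ⟪x₂, b⟫ * det₂ x₁ x₂ a d = ⟪x₂, a⟫ * det₂ x₁ x₂ b d + ⟪x₂, d⟫ * det₂ x₁ x₂ a b := by
    simp only [det₂]; ring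
  have : 0 ≤ ⟪x₂, b⟫ * det₂ x₁ x₂ a d := by rw [e]; positivity
  exact nonneg_of_mul_nonneg_right this hY

/-- The plane of w touches K at b, so b is not on the same side of the chord ad as m. The proof
evaluates w on the dependence of a, b, d, m. -/
theorem IsVertex.det₃_nonneg (hv : IsVertex K x₁ x₂ m) {w a b d : F} (hw : ∀ d ∈ K, 0 ≤ ⟪w, d⟫)
    (hwm : 0 < ⟪w, m⟫) (hwb : ⟪w, b⟫ = 0) (ha : a ∈ K) (hd : d ∈ K)
    (hab : 0 ≤ det₂ x₁ x₂ a b) (hbd : 0 ≤ det₂ x₁ x₂ b d) : 0 ≤ det₃ x₁ x₂ m a b d := by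
  have e := congrArg (fun y => ⟪w, y⟫) (hv.frame.det₃_smul a b d)
  simp only [inner_add_right, inner_sub_right, real_inner_smul_right, hwb] at e
  have h1 := mul_nonneg hbd (hw a ha)
  have h2 := mul_nonneg hab (hw d hd)
  exact nonneg_of_mul_nonneg_left (by linarith : 0 ≤ det₃ x₁ x₂ m a b d * ⟪w, m⟫) hwm

/-- No pair separates from `m` the pair of a nearest point. -/
theorem IsNearest.eq_or_det₂_pos (hb : CosBound K c) (hc1 : -1 < c) (hc : c < 0)
    (hv : IsVertex K x₁ x₂ m) {q u v : F} (hq : IsNearest K c x₁ x₂ m q)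
    (huv : IsPair K c u v) (hdet : 0 < det₂ x₁ x₂ u v) (hwm : 0 < ⟪v - c • u, m⟫) :
    u = c • q + √(1 - c ^ 2) • x₂ ∨ 0 < det₂ x₁ x₂ u (c • q + √(1 - c ^ 2) • x₂) := by
  set p := c • q + √(1 - c ^ 2) • x₂ with hp
  have hpq : IsPair K c p q := hq.pair
  by_contra hcon
  push Not at hcon
  obtain ⟨hne, hup⟩ := hcon
  -- Otherwise the directions seen from m come in the order p, u, v, q. The signs `c1`, `c2`, `c4`,
  -- `c5` make these the successive vertices of a convex quadrangle with opposite sides pq and uv.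
  have hpu : 0 ≤ det₂ x₁ x₂ p u := by
    have : det₂ x₁ x₂ p u = -det₂ x₁ x₂ u p := by simp only [det₂]; ring
    linarith
  have hXv : 0 < ⟪x₁, v⟫ := by
    by_contra hn
    have h0 : ⟪x₁, v⟫ = 0 := by linarith [hv.left_nonneg v huv.right_mem]
    rw [det₂, h0] at hdet
    nlinarith [mul_nonneg (hv.left_nonneg u huv.left_mem) (hv.right_nonneg v huv.right_mem)]
  have hdq : ∀ d ∈ K, 0 ≤ det₂ x₁ x₂ d q := by
    intro d hd
    rw [det₂, hq.inner_right, mul_zero, sub_zero]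
    exact mul_nonneg (hv.right_nonneg d hd) hq.inner_left.le
  have huq := hdq u huv.left_mem
  have hvq := hdq v huv.right_mem
  have hw : ∀ d ∈ K, 0 ≤ ⟪v - c • u, d⟫ := fun d hd => huv.normal_nonneg hb hd
  have hw' : ∀ d ∈ K, 0 ≤ ⟪u - c • v, d⟫ := fun d hd => huv.symm.normal_nonneg hb hd
  have hpv : 0 ≤ det₂ x₁ x₂ p v :=
    det₂_trans hv hpq.left_mem huv.left_mem huv.right_mem hpu hdet
  have c1 : 0 ≤ det₃ x₁ x₂ m p u q :=
    hv.det₃_nonneg hw hwm huv.inner_normal_left hpq.left_mem hpq.right_mem hpu huq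
  have c2 : 0 ≤ det₃ x₁ x₂ m p u v :=
    hv.det₃_nonneg hw hwm huv.inner_normal_left hpq.left_mem huv.right_mem hpu hdet.le
  have c3 : ∀ a ∈ K, 0 ≤ det₂ x₁ x₂ a v → 0 ≤ det₃ x₁ x₂ m a v q := by
    intro a ha hav
    rcases (hw' m hv.mem).lt_or_eq with hpos | hzero
    · exact hv.det₃_nonneg hw' hpos huv.symm.inner_normal_left ha hpq.right_mem hav hvq
    -- If the normal at v also vanishes at m, then ⟪x₁, v⟫ > 0 makes it a multiple of x₂. So v lies
    -- on the edge of q, and the sign comes from q being nearest to m.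
    · obtain ⟨α, β, hα, hβ, e⟩ := hv.normal _ hw' hzero.symm
      have h0 : ⟪u - c • v, v⟫ = 0 := huv.symm.inner_normal_left
      rw [e, inner_add_left, real_inner_smul_left, real_inner_smul_left] at h0
      have hYv := hv.right_nonneg v huv.right_mem
      have h01 := mul_nonneg hα hXv.le
      have h02 := mul_nonneg hβ hYv
      have hα0 : α = 0 := by
        rcases mul_eq_zero.mp (by linarith : α * ⟪x₁, v⟫ = 0) with h | h
        · exact h
        · linarith
      have hβY : β * ⟪x₂, v⟫ = 0 := by linarith
      rw [hα0, zero_smul, zero_add] at e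
      have hn := huv.symm.sq_norm_normal
      rw [e, norm_smul, hv.norm_right, mul_one, Real.norm_eq_abs, sq_abs] at hn
      have hβs : β = √(1 - c ^ 2) := by rw [← hn, Real.sqrt_sq hβ]
      have hβ0 : β ≠ 0 := by
        intro h; rw [h] at hn; nlinarith
      have hY0 : ⟪x₂, v⟫ = 0 := (mul_eq_zero.mp hβY).resolve_left hβ0
      have hu : u = c • v + √(1 - c ^ 2) • x₂ := by
        rw [← hβs, ← e]; module
      have hnear := hq.nearest v (hu ▸ huv) hY0
      have : det₃ x₁ x₂ m a v q =
          ⟪x₂, a⟫ * (⟪m, q⟫ * ⟪x₁, v⟫ - ⟪m, v⟫ * ⟪x₁, q⟫) := by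
        simp only [det₃, det₂, hY0, hq.inner_right]; ring
      rw [this]
      exact mul_nonneg (hv.right_nonneg a ha) (by linarith)
  have c4 := c3 u huv.left_mem hdet.le
  have c5 := c3 p hpq.left_mem hpv
  refine hne ?_
  -- In the degenerate case u, v, q lie in one plane, and v itself serves as the common point of the
  -- diagonals.
  by_cases h0 : det₃ x₁ x₂ m u v q = 0
  · have e := hv.frame.det₃_smul u v q
    rw [h0, zero_smul, eq_comm, sub_eq_zero] at e
    by_cases ho : det₂ x₁ x₂ u q • v = 0
    · have hz : det₂ x₁ x₂ v q • u + det₂ x₁ x₂ u v • q = 0 := by rw [e, ho]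
      have h1 := congrArg (fun y => ⟪x₁, y⟫) hz
      simp only [inner_add_right, real_inner_smul_right, inner_zero_right] at h1
      have := mul_nonneg hvq (hv.left_nonneg u huv.left_mem)
      have := mul_pos hdet hq.inner_left
      linarith
    · exact (hpq.no_quadrangle hb hc huv le_rfl huq hvq hdet.le ho
        (by rw [zero_smul, zero_add]) e.symm).symm
  · have hpos : 0 < det₃ x₁ x₂ m u v q := lt_of_le_of_ne c4 (Ne.symm h0)
    have e := hv.frame.quadrangle_relation p u v q
    refine (hpq.no_quadrangle hb hc huv c4 c1 c5 c2 ?_ rfl e).symm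
    intro hz
    have hvz : ⟪p - c • q, p⟫ = 1 - c ^ 2 := hpq.symm.inner_normal_right
    have h1 := congrArg (fun y => ⟪p - c • q, y⟫) hz
    simp only [inner_add_right, real_inner_smul_right, inner_zero_right, hvz] at h1
    have := mul_nonneg c1 (hpq.symm.normal_nonneg hb huv.right_mem)
    have : 0 < det₃ x₁ x₂ m u v q * (1 - c ^ 2) := mul_pos hpos (by nlinarith)
    linarith

/-- Let p be the opposite point of q. Either u = p, or p comes between u and z as seen from m; since
one supporting plane contains u and z, the supporting plane at p then contains z too. The edges from
p to z and from q to m are now orthogonal to the arc pq on opposite sides. -/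
theorem IsNearest.false_of_pair (hb : CosBound K c) (hc1 : -1 < c) (hc : c < 0)
    (hv : IsVertex K x₁ x₂ m) {q u v z : F} (hq : IsNearest K c x₁ x₂ m q)
    (huv : IsPair K c u v) (hdet : 0 < det₂ x₁ x₂ u v) (hz : z ∈ K)
    (hpz : 0 < det₂ x₁ x₂ (c • q + √(1 - c ^ 2) • x₂) z)
    (hwz : ⟪v - c • u, z⟫ = 0) (hwm : 0 < ⟪v - c • u, m⟫) : False := by
  have hor := hq.eq_or_det₂_pos hb hc1 hc hv huv hdet hwm
  have hpm : ⟪c • q + √(1 - c ^ 2) • x₂ - c • q, m⟫ = 0 := by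
    rw [add_sub_cancel_left, real_inner_smul_left, hv.frame.inner_right, mul_zero]
  have hYp : ⟪x₂, c • q + √(1 - c ^ 2) • x₂⟫ = √(1 - c ^ 2) := by
    rw [inner_add_right, real_inner_smul_right, real_inner_smul_right, hq.inner_right,
      real_inner_self_eq_norm_sq, hv.norm_right]
    ring
  set p := c • q + √(1 - c ^ 2) • x₂ with hp
  have hpq : IsPair K c p q := hq.pair
  have hs2 : 0 < 1 - c ^ 2 := by nlinarith
  have hs : 0 < √(1 - c ^ 2) := Real.sqrt_pos.mpr hs2
  have hg : ∀ d ∈ K, 0 ≤ ⟪q - c • p, d⟫ := fun d hd => hpq.normal_nonneg hb hd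
  have hD : 0 < det₂ x₁ x₂ p q := by
    rw [det₂, hq.inner_right, mul_zero, sub_zero, hYp]
    exact mul_pos hs hq.inner_left
  have hgz : ⟪q - c • p, z⟫ = 0 := by
    rcases hor with rfl | hup
    · rw [hpq.right_unique hb hc huv]; exact hwz
    · have huz : 0 ≤ det₂ x₁ x₂ u z :=
        det₂_trans hv huv.left_mem hpq.left_mem hz hup.le hpz
      have e := hv.frame.det₃_smul u p z
      have e1 := congrArg (fun y => ⟪v - c • u, y⟫) e
      have e2 := congrArg (fun y => ⟪q - c • p, y⟫) e
      simp only [inner_add_right, inner_sub_right, real_inner_smul_right, hwz,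
        huv.inner_normal_left, hpq.inner_normal_left] at e1 e2
      have f1 := mul_nonneg huz (huv.normal_nonneg hb hpq.left_mem)
      have hC : det₃ x₁ x₂ m u p z ≤ 0 := by
        by_contra hn
        push Not at hn
        have := mul_pos hn hwm
        linarith
      have f3 := mul_nonneg (neg_nonneg.mpr hC) (hg m hv.mem)
      have f4 := mul_nonneg hpz.le (hg u huv.left_mem)
      have f5 := mul_nonneg hup.le (hg z hz)
      exact (mul_eq_zero.mp (by linarith : det₂ x₁ x₂ u p * ⟪q - c • p, z⟫ = 0)).resolve_left
        hup.ne'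
  have hA : det₃ x₁ x₂ m p q z < 0 := by
    have e := congrArg (fun y => ⟪q - c • p, y⟫) (hv.frame.det₃_smul p q z)
    simp only [inner_add_right, inner_sub_right, real_inner_smul_right, hgz,
      hpq.inner_normal_left, hpq.inner_normal_right] at e
    by_contra hn
    push Not at hn
    have f1 := mul_nonneg hn (hg m hv.mem)
    have f2 := mul_pos hpz hs2
    linarith
  obtain ⟨hne, κ, hκ, hop⟩ := hv.frame.exists_opposite hpq hgz hpm hD hA
  exact hpq.no_opposite_edges hb hc1 hz hv.mem hgz hne hκ hop

end Cone

end Sph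

/-! ### A vertex belongs to a pair -/

namespace Sph

section Cone

open Filter Topology

variable {F : Type*} [NormedAddCommGroup F] [InnerProductSpace ℝ F]
variable {x₁ x₂ m : F} {K : ProperCone ℝ F} {c : ℝ}

/-- Each approximation of a vector `z` of `K` from outside of `K` comes with a pair, one of whose
normals is orthogonal to `z` and not positive in the direction of the approximation. -/
def HasLimitPairs (K : ProperCone ℝ F) (c : ℝ) : Prop :=
  ∀ z ∈ K, z ≠ 0 → ∀ (e : ℕ → F) (e₀ : F) (ε : ℕ → ℝ), Tendsto e atTop (𝓝 e₀) →
    Tendsto ε atTop (𝓝 0) → (∀ n, 0 < ε n) → (∀ n, z + ε n • e n ∉ K) →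
    ∃ u v, IsPair K c u v ∧ ⟪v - c • u, z⟫ = 0 ∧ ⟪v - c • u, e₀⟫ ≤ 0

theorem IsVertex.eq_of_inner_eq_zero (hb : CosBound K c) (hc1 : -1 < c)
    (hv : IsVertex K x₁ x₂ m) {u : F} (hu : u ∈ K) (hn : ‖u‖ = 1) (h1 : ⟪x₁, u⟫ = 0)
    (h2 : ⟪x₂, u⟫ = 0) : u = m := by
  have e : u = ⟪m, u⟫ • m := by
    apply hv.frame.ext_inner <;>
    simp [real_inner_smul_right, h1, h2, hv.frame.inner_left, hv.frame.inner_right,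
      hv.frame.norm_pole]
  have hm := hv.frame.norm_pole
  have ha : |⟪m, u⟫| = 1 := by
    have := congrArg norm e
    rw [norm_smul, hm, hn, mul_one, Real.norm_eq_abs] at this
    exact this.symm
  rcases (abs_eq zero_le_one).mp ha with h | h
  · rw [e, h, one_smul]
  · have := hb m hv.mem u hu
    rw [h, hm, hn] at this
    linarith

theorem IsVertex.add_pos (hb : CosBound K c) (hc1 : -1 < c) (hv : IsVertex K x₁ x₂ m)
    (hno : ∀ v, ¬ IsPair K c m v) {u v : F} (h : IsPair K c u v) : 0 < ⟪x₁, u⟫ + ⟪x₂, u⟫ := by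
  have h1 := hv.left_nonneg u h.left_mem
  have h2 := hv.right_nonneg u h.left_mem
  by_contra hn
  have := hv.eq_of_inner_eq_zero hb hc1 h.left_mem h.norm_left (by linarith) (by linarith)
  exact hno v (this ▸ h)

/-- If u, v and m were coplanar, a positive combination a v − b u would be a multiple r m. The
normal at u forces r > 0, whereas the normal at v is negative on a v − b u and nonnegative on m. -/
theorem IsVertex.det₂_ne_zero (hb : CosBound K c) (hc1 : -1 < c) (hc : c < 0)
    (hv : IsVertex K x₁ x₂ m) (hno : ∀ v, ¬ IsPair K c m v) {u v : F} (h : IsPair K c u v) :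
    det₂ x₁ x₂ u v ≠ 0 := by
  intro h0
  have hu := hv.add_pos hb hc1 hno h
  have hw := hv.add_pos hb hc1 hno h.symm
  set a := ⟪x₁, u⟫ + ⟪x₂, u⟫ with ha
  set b := ⟪x₁, v⟫ + ⟪x₂, v⟫ with hbdef
  rw [det₂] at h0
  have e : a • v - b • u = (a * ⟪m, v⟫ - b * ⟪m, u⟫) • m := by
    apply hv.frame.ext_inner <;>
    simp only [inner_sub_right, real_inner_smul_right, hv.frame.inner_left, hv.frame.inner_right,
      hv.frame.inner_self, ha, hbdef]
    · linear_combination h0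
    · linear_combination -h0
    · ring
  set r := a * ⟪m, v⟫ - b * ⟪m, u⟫
  have hs2 : 0 < 1 - c ^ 2 := by nlinarith
  have e1 := congrArg (fun y => ⟪v - c • u, y⟫) e
  have e2 := congrArg (fun y => ⟪u - c • v, y⟫) e
  simp only [inner_sub_right, real_inner_smul_right, h.inner_normal_left, h.inner_normal_right,
    h.symm.inner_normal_left, h.symm.inner_normal_right] at e1 e2
  have n1 := h.normal_nonneg hb hv.mem
  have n2 := h.symm.normal_nonneg hb hv.mem
  have p1 := mul_pos hu hs2
  have p2 := mul_pos hw hs2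
  have hr : 0 < r := by
    by_contra hr
    push Not at hr
    have := mul_nonneg (neg_nonneg.mpr hr) n1
    linarith
  have := mul_nonneg hr.le n2
  linarith

/-- The vector τ is tangent at m to the edge orthogonal to x₂. Vectors m + ε (τ − ε x₂) lie outside
K, and the limit normal α x₁ + β x₂ is not positive on τ. As τ is orthogonal to x₂, this gives α =
0, so the normal is a multiple of x₂. -/
theorem IsVertex.exists_edge_pair (hb : CosBound K c) (hc1 : -1 < c) (hc : c < 0)
    (hv : IsVertex K x₁ x₂ m) (hg : ⟪x₁, x₂⟫ ^ 2 < 1) (hV : HasLimitPairs K c) :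
    ∃ q, IsPair K c (c • q + √(1 - c ^ 2) • x₂) q ∧ ⟪x₂, q⟫ = 0 := by
  set τ := x₁ - ⟪x₁, x₂⟫ • x₂ with hτ
  have hs2 : 0 < 1 - c ^ 2 := by nlinarith
  have h22 : ⟪x₂, x₂⟫ = 1 := by rw [real_inner_self_eq_norm_sq, hv.norm_right]; norm_num
  have h11 : ⟪x₁, x₁⟫ = 1 := by rw [real_inner_self_eq_norm_sq, hv.norm_left]; norm_num
  have h21 : ⟪x₂, x₁⟫ = ⟪x₁, x₂⟫ := real_inner_comm _ _
  have hm0 : m ≠ 0 := by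
    intro h; have := hv.frame.norm_pole; rw [h, norm_zero] at this; norm_num at this
  have ht : Tendsto (fun n : ℕ => 1 / ((n : ℝ) + 1)) atTop (𝓝 0) :=
    tendsto_one_div_add_atTop_nhds_zero_nat
  have ht2 : Tendsto (fun n : ℕ => τ - (1 / ((n : ℝ) + 1)) • x₂) atTop (𝓝 τ) := by
    have := (tendsto_const_nhds (x := τ)).sub (ht.smul_const x₂)
    simpa using this
  obtain ⟨u, v, huv, hwm, hwτ⟩ := hV m hv.mem hm0 _ τ _ ht2 ht (fun n => by positivity) (by
    intro n hn
    have h := hv.right_nonneg _ hn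
    rw [inner_add_right, hv.frame.inner_right, real_inner_smul_right, inner_sub_right, hτ,
      inner_sub_right, real_inner_smul_right, real_inner_smul_right, h22, h21] at h
    have : 0 < 1 / ((n : ℝ) + 1) * (1 / ((n : ℝ) + 1)) := by positivity
    linarith)
  obtain ⟨α, β, hα, hβ, e⟩ := hv.normal _ (fun d hd => huv.normal_nonneg
    hb hd) hwm
  have hα0 : α = 0 := by
    rw [e, hτ] at hwτ
    simp only [inner_add_left, inner_sub_right, real_inner_smul_left, real_inner_smul_right, h11,
      h22, h21] at hwτ
    nlinarith
  rw [hα0, zero_smul, zero_add] at e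
  have hn := huv.sq_norm_normal
  rw [e, norm_smul, hv.norm_right, mul_one, Real.norm_eq_abs, sq_abs] at hn
  have hβs : β = √(1 - c ^ 2) := by rw [← hn, Real.sqrt_sq hβ]
  have hβ0 : β ≠ 0 := by
    intro h; rw [h] at hn; nlinarith
  have hv' : v = c • u + √(1 - c ^ 2) • x₂ := by
    rw [← hβs, ← e]; module
  refine ⟨u, hv' ▸ huv.symm, ?_⟩
  have h0 := huv.inner_normal_left
  rw [e, real_inner_smul_left] at h0
  exact (mul_eq_zero.mp h0).resolve_left hβ0

theorem IsVertex.exists_isNearest [FiniteDimensional ℝ F] (hb : CosBound K c) (hc1 : -1 < c)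
    (hc : c < 0) (hv : IsVertex K x₁ x₂ m) (hg : ⟪x₁, x₂⟫ ^ 2 < 1) (hV : HasLimitPairs K c)
    (hno : ∀ v, ¬ IsPair K c m v) : ∃ q, IsNearest K c x₁ x₂ m q := by
  set s := √(1 - c ^ 2) with hs
  set S : Set F := {v | IsPair K c (c • v + s • x₂) v ∧ ⟪x₂, v⟫ = 0} with hS
  have hcl : IsClosed S := by
    have : S = ((fun v : F => c • v + s • x₂) ⁻¹' (K : Set F) ∩ (K : Set F)) ∩
        ({v | ‖c • v + s • x₂‖ = 1} ∩ {v | ‖v‖ = 1}) ∩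
        ({v | ⟪c • v + s • x₂, v⟫ = c} ∩ {v | ⟪x₂, v⟫ = 0}) := by
      ext v
      constructor
      · rintro ⟨⟨a, b, d, e, f⟩, g⟩; exact ⟨⟨⟨a, b⟩, d, e⟩, f, g⟩
      · rintro ⟨⟨⟨a, b⟩, d, e⟩, f, g⟩; exact ⟨⟨a, b, d, e, f⟩, g⟩
    rw [this]
    refine (((K.isClosed.preimage (by fun_prop)).inter K.isClosed).inter
      ((isClosed_eq (by fun_prop) (by fun_prop)).inter
        (isClosed_eq (by fun_prop) (by fun_prop)))).inter
      ((isClosed_eq (by fun_prop) (by fun_prop)).inter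
        (isClosed_eq (by fun_prop) (by fun_prop)))
  have hcomp : IsCompact S := by
    refine (isCompact_sphere (0 : F) 1).of_isClosed_subset hcl ?_
    rintro v ⟨h, -⟩
    simpa using h.norm_right
  have hpos : ∀ v ∈ S, 0 < ⟪x₁, v⟫ := by
    rintro v ⟨h, h0⟩
    have := hv.add_pos hb hc1 hno h.symm
    rwa [h0, add_zero] at this
  -- Along the edge this quotient is a positive multiple of the cotangent of the angle from m, so
  -- its maximum is at the nearest point.
  obtain ⟨q, hq, hmax⟩ := hcomp.exists_isMaxOn (f := fun v => ⟪m, v⟫ / ⟪x₁, v⟫)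
    (hv.exists_edge_pair hb hc1 hc hg hV)
    (ContinuousOn.div (by fun_prop) (by fun_prop) fun v h => (hpos v h).ne')
  refine ⟨q, hq.1, hq.2, hpos q hq, fun v h h0 => ?_⟩
  have h1 : ⟪m, v⟫ / ⟪x₁, v⟫ ≤ ⟪m, q⟫ / ⟪x₁, q⟫ := hmax ⟨h, h0⟩
  rwa [div_le_div_iff₀ (hpos v ⟨h, h0⟩) (hpos q hq)] at h1

/-- For large t the vector y − t m is nearly opposite to m, which c > −1 forbids in K; closedness
then gives a last t. -/
theorem exists_max_sub_smul (hb : CosBound K c) (hc1 : -1 < c) (hc : c < 0)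
    (hm : m ∈ K) (hn : ‖m‖ = 1) {y : F} (hy : y ∈ K) :
    ∃ t : ℝ, y - t • m ∈ K ∧ ∀ t' > t, y - t' • m ∉ K := by
  set S : Set ℝ := {t | 0 ≤ t ∧ y - t • m ∈ K} with hS
  have hcl : IsClosed S :=
    (isClosed_le continuous_const continuous_id).inter
      (K.isClosed.preimage (by fun_prop : Continuous fun t : ℝ => y - t • m))
  have hbd : ∀ t ∈ S, t ≤ ‖y‖ * (1 - c) / (1 + c) := by
    rintro t ⟨ht, htK⟩
    have h := hb m hm _ htK
    rw [hn, one_mul, inner_sub_right, real_inner_smul_right, real_inner_self_eq_norm_sq, hn] at h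
    have h1 : ‖y - t • m‖ ≤ ‖y‖ + t := by
      refine (norm_sub_le _ _).trans ?_
      rw [norm_smul, hn, mul_one, Real.norm_eq_abs, abs_of_nonneg ht]
    have h2 : ⟪m, y⟫ ≤ ‖y‖ := by
      simpa [hn] using real_inner_le_norm m y
    rw [le_div_iff₀ (by linarith)]
    nlinarith
  have hS0 : (0 : ℝ) ∈ S := ⟨le_rfl, by simpa using hy⟩
  have hba : BddAbove S := ⟨_, hbd⟩
  have hmem := hcl.csSup_mem ⟨0, hS0⟩ hba
  refine ⟨sSup S, hmem.2, fun t' ht' hK => ?_⟩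
  exact absurd (le_csSup hba (show t' ∈ S from ⟨hmem.1.trans ht'.le, hK⟩)) (not_le.mpr ht')

theorem det₂_swap (a b : F) : det₂ x₂ x₁ a b = -det₂ x₁ x₂ a b := by
  simp only [det₂]; ring

/-- In a cone with limit pairs, each vertex belongs to a pair. -/
theorem IsVertex.exists_isPair [FiniteDimensional ℝ F] (hb : CosBound K c) (hc1 : -1 < c)
    (hc : c < 0) (hv : IsVertex K x₁ x₂ m) (hg : ⟪x₁, x₂⟫ ^ 2 < 1) (hV : HasLimitPairs K c) :
    ∃ v, IsPair K c m v := by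
  by_contra hno
  push Not at hno
  obtain ⟨k₂, hk₂⟩ := hv.exists_isNearest hb hc1 hc hg hV hno
  obtain ⟨k₁, hk₁⟩ := hv.swap.exists_isNearest hb hc1 hc
    (by rwa [real_inner_comm]) hV hno
  have hs2 : 0 < 1 - c ^ 2 := by nlinarith
  have hs : 0 < √(1 - c ^ 2) := Real.sqrt_pos.mpr hs2
  have h22 : ⟪x₂, x₂⟫ = 1 := by rw [real_inner_self_eq_norm_sq, hv.norm_right]; norm_num
  have h11 : ⟪x₁, x₁⟫ = 1 := by rw [real_inner_self_eq_norm_sq, hv.norm_left]; norm_num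
  have h21 : ⟪x₂, x₁⟫ = ⟪x₁, x₂⟫ := real_inner_comm _ _
  have hg1 : ⟪x₁, x₂⟫ < 1 := by nlinarith
  have hX1 : ⟪x₁, c • k₁ + √(1 - c ^ 2) • x₁⟫ = √(1 - c ^ 2) := by
    rw [inner_add_right, real_inner_smul_right, real_inner_smul_right, hk₁.inner_right, h11]; ring
  have hY2 : ⟪x₂, c • k₂ + √(1 - c ^ 2) • x₂⟫ = √(1 - c ^ 2) := by
    rw [inner_add_right, real_inner_smul_right, real_inner_smul_right, hk₂.inner_right, h22]; ring
  have hY1 : ⟪x₂, c • k₁ + √(1 - c ^ 2) • x₁⟫ < √(1 - c ^ 2) := by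
    rw [inner_add_right, real_inner_smul_right, real_inner_smul_right, h21]
    nlinarith [hk₁.inner_left]
  have hX2 : ⟪x₁, c • k₂ + √(1 - c ^ 2) • x₂⟫ < √(1 - c ^ 2) := by
    rw [inner_add_right, real_inner_smul_right, real_inner_smul_right]
    nlinarith [hk₂.inner_left]
  have hp1 := hk₁.pair.left_mem
  have hp2 := hk₂.pair.left_mem
  -- Subtracting multiples of m keeps the direction seen from m, so z lies strictly between p₂ and
  -- p₁, on the boundary of K away from m.
  obtain ⟨t, htK, htmax⟩ := exists_max_sub_smul hb hc1 hc hv.mem hv.frame.norm_pole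
    (K.add_mem hp1 hp2)
  set p₁ := c • k₁ + √(1 - c ^ 2) • x₁ with hp1def
  set p₂ := c • k₂ + √(1 - c ^ 2) • x₂ with hp2def
  set z := p₁ + p₂ - t • m with hz
  have n1 := hv.right_nonneg p₁ hp1
  have n2 := hv.left_nonneg p₂ hp2
  have hdet : 0 < det₂ x₁ x₂ p₂ p₁ := by
    rw [det₂, hX1, hY2]
    nlinarith
  have hXz : 0 < ⟪x₁, z⟫ := by
    rw [hz, inner_sub_right, inner_add_right, real_inner_smul_right, hv.frame.inner_left, hX1]
    linarith
  have hYz : 0 < ⟪x₂, z⟫ := by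
    rw [hz, inner_sub_right, inner_add_right, real_inner_smul_right, hv.frame.inner_right, hY2]
    linarith
  have hd2 : 0 < det₂ x₁ x₂ p₂ z := by
    have : det₂ x₁ x₂ p₂ z = det₂ x₁ x₂ p₂ p₁ := by
      rw [hz]
      simp only [det₂, inner_sub_right, inner_add_right, real_inner_smul_right,
        hv.frame.inner_left, hv.frame.inner_right]
      ring
    rw [this]; exact hdet
  have hd1 : 0 < det₂ x₂ x₁ p₁ z := by
    have : det₂ x₂ x₁ p₁ z = det₂ x₁ x₂ p₂ p₁ := by
      rw [hz]
      simp only [det₂, inner_sub_right, inner_add_right, real_inner_smul_right,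
        hv.frame.inner_left, hv.frame.inner_right]
      ring
    rw [this]; exact hdet
  have hz0 : z ≠ 0 := by
    intro h; rw [h, inner_zero_right] at hXz; exact lt_irrefl _ hXz
  obtain ⟨u, v, huv, hwz, -⟩ := hV z htK hz0 (fun _ => -m) (-m) (fun n : ℕ => 1 / ((n : ℝ) + 1))
    tendsto_const_nhds tendsto_one_div_add_atTop_nhds_zero_nat (fun n => by positivity) (by
      intro n hn
      have hpos : 0 < 1 / ((n : ℝ) + 1) := by positivity
      refine htmax (t + 1 / ((n : ℝ) + 1)) (by linarith) ?_
      convert hn using 1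
      rw [hz]; module)
  -- A normal vanishing at m is a nonnegative combination of x₁ and x₂. Both are positive at z, so
  -- vanishing at z would make it zero.
  have hwm : 0 < ⟪v - c • u, m⟫ := by
    refine lt_of_le_of_ne (huv.normal_nonneg hb hv.mem) fun h0 => ?_
    obtain ⟨α, β, hα, hβ, e⟩ := hv.normal _ (fun d hd => huv.normal_nonneg hb hd) h0.symm
    have hn := huv.sq_norm_normal
    rw [e, inner_add_left, real_inner_smul_left, real_inner_smul_left] at hwz
    have f1 := mul_nonneg hα hXz.le
    have f2 := mul_nonneg hβ hYz.le
    have hα0 := (mul_eq_zero.mp (by linarith : α * ⟪x₁, z⟫ = 0)).resolve_right hXz.ne'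
    have hβ0 := (mul_eq_zero.mp (by linarith : β * ⟪x₂, z⟫ = 0)).resolve_right hYz.ne'
    rw [e, hα0, hβ0] at hn
    simp at hn
    linarith
  -- The orientation of u, v decides which edge gives the contradiction; the two cases differ by
  -- exchanging x₁ and x₂.
  rcases (hv.det₂_ne_zero hb hc1 hc hno huv).lt_or_gt with h | h
  · exact hk₁.false_of_pair hb hc1 hc hv.swap huv (by rw [det₂_swap]; linarith) htK hd1 hwz hwm
  · exact hk₂.false_of_pair hb hc1 hc hv huv h htK hd2 hwz hwm

end Cone

end Sph

/-! ### The polar cone of a convex body, width and thickness -/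

namespace Sph

noncomputable section

open Filter Topology

/-- The cone of the vectors having nonnegative inner product with all points of `C`. Its unit
vectors are the centers of the hemispheres containing `C`. -/
def polar (C : Set S2) : ProperCone ℝ (EuclideanSpace ℝ (Fin 3)) :=
  ProperCone.innerDual ((fun x : S2 => (x : EuclideanSpace ℝ (Fin 3))) '' C)

theorem mem_polar {C : Set S2} {y : EuclideanSpace ℝ (Fin 3)} :
    y ∈ polar C ↔ ∀ x ∈ C, 0 ≤ ⟪y, (x : EuclideanSpace ℝ (Fin 3))⟫ := by
  simp [polar, ProperCone.mem_innerDual, real_inner_comm]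

theorem norm_coe (x : S2) : ‖(x : EuclideanSpace ℝ (Fin 3))‖ = 1 := by simp

theorem inner_coe_self (x : S2) :
    ⟪(x : EuclideanSpace ℝ (Fin 3)), (x : EuclideanSpace ℝ (Fin 3))⟫ = 1 := by
  rw [real_inner_self_eq_norm_sq, norm_coe]; norm_num

theorem ip_comm (x y : S2) : ip x y = ip y x := real_inner_comm _ _

theorem abs_ip_le (x y : S2) : |ip x y| ≤ 1 := by
  simpa [ip] using abs_real_inner_le_norm (x : EuclideanSpace ℝ (Fin 3)) y

theorem eq_of_ip_eq_one {x y : S2} (h : ip x y = 1) : x = y :=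
  Subtype.ext ((inner_eq_one_iff_of_norm_eq_one (norm_coe x) (norm_coe y)).mp h)

theorem eq_neg_of_ip_eq_neg_one {x y : S2} (h : ip x y = -1) : x = -y := by
  apply eq_of_ip_eq_one
  have h' : inner ℝ (x : EuclideanSpace ℝ (Fin 3)) (y : EuclideanSpace ℝ (Fin 3)) = -1 := h
  simp [ip, h']

/-- The point of the sphere in the direction of a nonzero vector. -/
def direction (w : EuclideanSpace ℝ (Fin 3)) (hw : w ≠ 0) : S2 :=
  ⟨‖w‖⁻¹ • w, by
    rw [mem_sphere_zero_iff_norm, norm_smul, norm_inv, norm_norm,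
      inv_mul_cancel₀ (norm_ne_zero_iff.mpr hw)]⟩

theorem coe_direction {w : EuclideanSpace ℝ (Fin 3)} (hw : w ≠ 0) :
    (direction w hw : EuclideanSpace ℝ (Fin 3)) = ‖w‖⁻¹ • w := rfl

theorem norm_smul_direction {w : EuclideanSpace ℝ (Fin 3)} (hw : w ≠ 0) :
    ‖w‖ • (direction w hw : EuclideanSpace ℝ (Fin 3)) = w := by
  rw [coe_direction, smul_smul, mul_inv_cancel₀ (norm_ne_zero_iff.mpr hw), one_smul]

theorem direction_mem_polar {C : Set S2} {w : EuclideanSpace ℝ (Fin 3)} (hw : w ≠ 0)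
    (h : w ∈ polar C) : (direction w hw : EuclideanSpace ℝ (Fin 3)) ∈ polar C := by
  rw [coe_direction]
  exact smul_mem_cone (by positivity) h

theorem direction_mem_arc {a b : S2} {s t : ℝ} (hs : 0 ≤ s) (ht : 0 ≤ t)
    {w : EuclideanSpace ℝ (Fin 3)} (hw : w ≠ 0)
    (e : w = s • (a : EuclideanSpace ℝ (Fin 3)) + t • (b : EuclideanSpace ℝ (Fin 3))) :
    direction w hw ∈ arc a b := by
  refine ⟨‖w‖⁻¹ * s, ‖w‖⁻¹ * t, by positivity, by positivity, ?_⟩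
  rw [coe_direction, mul_smul, mul_smul, ← smul_add, ← e]

theorem IsConvexBody.nonempty {C : Set S2} (hC : IsConvexBody C) : C.Nonempty :=
  hC.interior_nonempty.mono interior_subset

theorem IsConvex.combination {C : Set S2} (hC : IsConvex C) {x y : S2} (hx : x ∈ C) (hy : y ∈ C)
    {s t : ℝ} (hs : 0 ≤ s) (ht : 0 ≤ t) {w : EuclideanSpace ℝ (Fin 3)}
    (e : w = s • (x : EuclideanSpace ℝ (Fin 3)) + t • (y : EuclideanSpace ℝ (Fin 3))) :
    ∃ z ∈ C, w = ‖w‖ • (z : EuclideanSpace ℝ (Fin 3)) := by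
  by_cases hw : w = 0
  · exact ⟨x, hx, by simp [hw]⟩
  · exact ⟨direction w hw, hC.2 x hx y hy (direction_mem_arc hs ht hw e),
      (norm_smul_direction hw).symm⟩

/-- The cone generated by a convex body. -/
def IsConvexBody.cone {C : Set S2} (hC : IsConvexBody C) :
    ProperCone ℝ (EuclideanSpace ℝ (Fin 3)) where
  carrier := {w | ∃ x ∈ C, w = ‖w‖ • (x : EuclideanSpace ℝ (Fin 3))}
  add_mem' := by
    rintro a b ⟨x, hx, ea⟩ ⟨y, hy, eb⟩
    exact hC.isConvex.combination hx hy (norm_nonneg a) (norm_nonneg b) (by rw [← ea, ← eb])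
  zero_mem' := by
    obtain ⟨x, hx⟩ := hC.nonempty
    exact ⟨x, hx, by simp⟩
  smul_mem' := by
    rintro ⟨t, ht⟩ a ⟨x, hx, ea⟩
    refine hC.isConvex.combination hx hx (s := t * ‖a‖) (by positivity) le_rfl ?_
    rw [zero_smul, add_zero, mul_smul, ← ea]
    rfl
  isClosed' := by
    -- The cone is the projection of this closed set along the compact sphere.
    have hcl : IsClosed {p : EuclideanSpace ℝ (Fin 3) × S2 |
        p.2 ∈ C ∧ p.1 = ‖p.1‖ • (p.2 : EuclideanSpace ℝ (Fin 3))} :=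
      (hC.isClosed.preimage continuous_snd).inter (isClosed_eq (by fun_prop) (by fun_prop))
    have := isClosedMap_fst_of_compactSpace _ hcl
    convert this using 1
    ext w
    constructor
    · rintro ⟨x, hx, e⟩
      exact ⟨(w, x), ⟨hx, e⟩, rfl⟩
    · rintro ⟨⟨w', x⟩, ⟨hx, e⟩, rfl⟩
      exact ⟨x, hx, e⟩

theorem IsConvexBody.mem_cone {C : Set S2} (hC : IsConvexBody C)
    {w : EuclideanSpace ℝ (Fin 3)} :
    w ∈ hC.cone ↔ ∃ x ∈ C, w = ‖w‖ • (x : EuclideanSpace ℝ (Fin 3)) := Iff.rfl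

/-- Bipolar theorem for the cone generated by a convex body. -/
theorem IsConvexBody.exists_of_nonneg {C : Set S2} (hC : IsConvexBody C)
    {w : EuclideanSpace ℝ (Fin 3)} (hw : ∀ d ∈ polar C, 0 ≤ ⟪w, d⟫) :
    ∃ x ∈ C, w = ‖w‖ • (x : EuclideanSpace ℝ (Fin 3)) := by
  rw [← hC.mem_cone]
  by_contra hn
  obtain ⟨y, hy, hlt⟩ := hC.cone.hyperplane_separation' hn
  have : y ∈ polar C := by
    rw [mem_polar]
    intro x hx
    rw [real_inner_comm]
    exact hy _ (hC.mem_cone.mpr ⟨x, hx, by simp⟩)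
  exact absurd (hw y this) (not_le.mpr hlt)

/-- If the product were zero, moving o slightly along a great circle away from d would leave the
hemisphere of d while staying in C. -/
theorem inner_pos_of_mem_interior {C : Set S2} {o : S2} (ho : o ∈ interior C)
    {d : EuclideanSpace ℝ (Fin 3)} (hd : d ∈ polar C) (hd0 : d ≠ 0) :
    0 < ⟪d, (o : EuclideanSpace ℝ (Fin 3))⟫ := by
  rw [mem_polar] at hd
  refine lt_of_le_of_ne (hd o (interior_subset ho)) fun h0 => ?_
  set k := direction d hd0 with hk
  have hdk : ‖d‖ • (k : EuclideanSpace ℝ (Fin 3)) = d := norm_smul_direction hd0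
  have hnd : 0 < ‖d‖ := norm_pos_iff.mpr hd0
  have hko : ⟪(o : EuclideanSpace ℝ (Fin 3)), (k : EuclideanSpace ℝ (Fin 3))⟫ = 0 := by
    rw [hk, coe_direction, real_inner_smul_right, real_inner_comm, ← h0, mul_zero]
  let f : ℝ → S2 := fun t =>
    ⟨Real.cos t • (o : EuclideanSpace ℝ (Fin 3)) - Real.sin t • (k : EuclideanSpace ℝ (Fin 3)), by
      rw [mem_sphere_zero_iff_norm, ← sq_eq_sq₀ (norm_nonneg _) zero_le_one, norm_sub_sq_real,
        norm_smul, norm_smul, norm_coe, norm_coe, real_inner_smul_left, real_inner_smul_right, hko]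
      simp⟩
  have hf : Continuous f := by
    refine Continuous.subtype_mk ?_ _
    fun_prop
  have hf0 : f 0 = o := Subtype.ext (by simp [f])
  have h1 : ∀ᶠ t in 𝓝[>] (0 : ℝ), f t ∈ C :=
    nhdsWithin_le_nhds (hf.continuousAt (by rw [hf0]; exact mem_interior_iff_mem_nhds.mp ho))
  have h2 : ∀ᶠ t in 𝓝[>] (0 : ℝ), t ∈ Set.Ioo (0 : ℝ) 1 := Ioo_mem_nhdsGT one_pos
  obtain ⟨t, ht, ht0, ht1⟩ := (h1.and h2).exists
  have h3 := hd _ ht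
  have h4 : ⟪d, (f t : EuclideanSpace ℝ (Fin 3))⟫ = -(Real.sin t * ‖d‖) := by
    have : ⟪d, (k : EuclideanSpace ℝ (Fin 3))⟫ = ‖d‖ := by
      conv_lhs => rw [← hdk]
      rw [real_inner_smul_left, inner_coe_self, mul_one]
    simp only [f, inner_sub_right, real_inner_smul_right, ← h0, this]
    ring
  have h5 : 0 < Real.sin t := Real.sin_pos_of_pos_of_lt_pi ht0 (by linarith [Real.pi_gt_three])
  have := mul_pos h5 hnd
  linarith

theorem Supports.mem_polar {C : Set S2} {k : S2} (h : Supports k C) :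
    (k : EuclideanSpace ℝ (Fin 3)) ∈ polar C :=
  Sph.mem_polar.mpr fun _ hx => h.1 hx

theorem coe_ne_zero (x : S2) : (x : EuclideanSpace ℝ (Fin 3)) ≠ 0 := by
  intro h
  have := norm_coe x
  rw [h, norm_zero] at this
  norm_num at this

theorem mem_frontier_of_ip_eq_zero {C : Set S2} {k x : S2}
    (hk : (k : EuclideanSpace ℝ (Fin 3)) ∈ polar C) (hx : x ∈ C) (h : ip k x = 0) :
    x ∈ frontier C := by
  refine ⟨subset_closure hx, fun hi => ?_⟩
  have := inner_pos_of_mem_interior hi hk (coe_ne_zero k)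
  exact this.ne' h

theorem IsConvexBody.neg_notMem_polar {C : Set S2} (hC : IsConvexBody C)
    {d : EuclideanSpace ℝ (Fin 3)} (hd : d ∈ polar C) (hd0 : d ≠ 0) : -d ∉ polar C := by
  intro h
  obtain ⟨o, ho⟩ := hC.interior_nonempty
  have h1 := inner_pos_of_mem_interior ho hd hd0
  have h2 := inner_pos_of_mem_interior ho h (neg_ne_zero.mpr hd0)
  rw [inner_neg_left] at h2
  linarith

theorem exists_inner_eq_zero (k : S2) :
    ∃ w : S2, ⟪(w : EuclideanSpace ℝ (Fin 3)), (k : EuclideanSpace ℝ (Fin 3))⟫ = 0 := by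
  have hlt : Module.finrank ℝ (ℝ ∙ (k : EuclideanSpace ℝ (Fin 3))) <
      Module.finrank ℝ (EuclideanSpace ℝ (Fin 3)) := by
    rw [finrank_span_singleton (coe_ne_zero k), finrank_euclideanSpace_fin]; norm_num
  have hne : (ℝ ∙ (k : EuclideanSpace ℝ (Fin 3)))ᗮ ≠ ⊥ := by
    rw [Ne, Submodule.orthogonal_eq_bot_iff]
    intro h
    rw [h, finrank_top] at hlt
    exact lt_irrefl _ hlt
  obtain ⟨w, hw, hw0⟩ := Submodule.exists_mem_ne_zero_of_ne_bot hne
  refine ⟨direction w hw0, ?_⟩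
  rw [coe_direction, real_inner_smul_left, Submodule.mem_orthogonal_singleton_iff_inner_left.mp hw,
    mul_zero]

/-- If the polar cone had no unit vector besides k, the bipolar theorem would put both w and −w in C
for any unit w orthogonal to k. -/
theorem IsConvexBody.exists_mem_polar_ne {C : Set S2} (hC : IsConvexBody C) (k : S2) :
    ∃ d : S2, (d : EuclideanSpace ℝ (Fin 3)) ∈ polar C ∧ d ≠ k := by
  by_contra! hall
  obtain ⟨w, hw⟩ := exists_inner_eq_zero k
  have hz : ∀ d ∈ polar C, ⟪(w : EuclideanSpace ℝ (Fin 3)), d⟫ = 0 := by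
    intro d hd
    by_cases hd0 : d = 0
    · rw [hd0, inner_zero_right]
    · rw [← norm_smul_direction hd0, hall _ (direction_mem_polar hd0 hd), real_inner_smul_right,
        hw, mul_zero]
  obtain ⟨x, hx, ex⟩ := hC.exists_of_nonneg fun d hd => (hz d hd).ge
  obtain ⟨y, hy, ey⟩ := hC.exists_of_nonneg (w := -(w : EuclideanSpace ℝ (Fin 3))) fun d hd => by
    rw [inner_neg_left, hz d hd, neg_zero]
  rw [norm_coe, one_smul] at ex
  rw [norm_neg, norm_coe, one_smul] at ey
  refine hC.isConvex.1 x hx ?_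
  have : -x = y := Subtype.ext (by simp [← ex, ← ey])
  rwa [this]

/-- `y` is the center of a hemisphere containing `C` that is farthest from `k`. -/
def IsFarthest (C : Set S2) (k y : S2) : Prop :=
  (y : EuclideanSpace ℝ (Fin 3)) ∈ polar C ∧
    ∀ h : S2, (h : EuclideanSpace ℝ (Fin 3)) ∈ polar C → ip k y ≤ ip k h

theorem isCompact_polar (C : Set S2) :
    IsCompact {k : S2 | (k : EuclideanSpace ℝ (Fin 3)) ∈ polar C} :=
  ((polar C).isClosed.preimage continuous_subtype_val).isCompact

theorem continuous_ip : Continuous fun p : S2 × S2 => ip p.1 p.2 := by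
  unfold ip; fun_prop

theorem IsConvexBody.exists_isFarthest {C : Set S2} (hC : IsConvexBody C) (k : S2) :
    ∃ y, IsFarthest C k y := by
  obtain ⟨d, hd, -⟩ := hC.exists_mem_polar_ne k
  obtain ⟨y, hy, hmin⟩ := (isCompact_polar C).exists_isMinOn (f := fun h => ip k h) ⟨d, hd⟩
    (continuous_ip.comp (by fun_prop : Continuous fun h : S2 => (k, h))).continuousOn
  exact ⟨y, hy, fun h hh => hmin hh⟩

theorem IsFarthest.le_inner {C : Set S2} {k y : S2} (h : IsFarthest C k y)
    {d : EuclideanSpace ℝ (Fin 3)} (hd : d ∈ polar C) :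
    ip k y * ‖d‖ ≤ ⟪(k : EuclideanSpace ℝ (Fin 3)), d⟫ := by
  by_cases hd0 : d = 0
  · simp [hd0]
  · have := h.2 _ (direction_mem_polar hd0 hd)
    rw [← norm_smul_direction hd0, real_inner_smul_right, norm_smul, norm_coe, norm_norm, mul_one,
      mul_comm]
    exact mul_le_mul_of_nonneg_left this (norm_nonneg d)

theorem IsFarthest.formLune {C : Set S2} (hC : IsConvexBody C) {k y : S2}
    (hk : (k : EuclideanSpace ℝ (Fin 3)) ∈ polar C) (h : IsFarthest C k y) : FormLune k y := by
  constructor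
  · rintro rfl
    obtain ⟨d, hd, hne⟩ := hC.exists_mem_polar_ne y
    have h1 := h.2 d hd
    have h2 : ip y y = 1 := inner_coe_self y
    have h3 := (abs_le.mp (abs_ip_le y d)).2
    exact hne (eq_of_ip_eq_one (by linarith)).symm
  · rintro rfl
    exact hC.neg_notMem_polar hk (coe_ne_zero k) (by simpa using h.1)

/-- By the first-order condition and the bipolar theorem, the component of k orthogonal to y is a
multiple of a point of C, which is the point of contact. Hence minimizing over containing
hemispheres suffices for the width. -/
theorem IsFarthest.supports {C : Set S2} (hC : IsConvexBody C) {k y : S2}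
    (hk : (k : EuclideanSpace ℝ (Fin 3)) ∈ polar C) (h : IsFarthest C k y) : Supports y C := by
  have hl := h.formLune hC hk
  obtain ⟨x, hx, e⟩ := hC.exists_of_nonneg fun d hd =>
    inner_sub_smul_nonneg (fun d hd => h.le_inner hd) h.1 (norm_coe y) rfl hd
  have hne : (k : EuclideanSpace ℝ (Fin 3)) - ip k y • (y : EuclideanSpace ℝ (Fin 3)) ≠ 0 := by
    have := centerDir_ne_zero (g := y) (h := k)
      ⟨hl.1.symm, fun h => hl.2 (by rw [h, neg_neg])⟩
    rwa [centerDir, ip_comm] at this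
  have hyx : ip y x = 0 := by
    have h0 : ⟪(y : EuclideanSpace ℝ (Fin 3)),
        (k : EuclideanSpace ℝ (Fin 3)) - ip k y • (y : EuclideanSpace ℝ (Fin 3))⟫ = 0 := by
      rw [inner_sub_right, real_inner_smul_right, inner_coe_self, real_inner_comm, ip]; ring
    rw [e, real_inner_smul_right] at h0
    exact (mul_eq_zero.mp h0).resolve_left (norm_ne_zero_iff.mpr hne)
  exact ⟨fun z hz => mem_polar.mp h.1 z hz, x, mem_frontier_of_ip_eq_zero h.1 hx hyx, hyx⟩

theorem FormLune.symm {g h : S2} (H : FormLune g h) : FormLune h g :=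
  ⟨H.1.symm, fun e => H.2 (by rw [e, neg_neg])⟩

theorem coe_semicircleCenter {g h : S2} (H : FormLune g h) :
    semicircleCenter g h = direction (centerDir g h) (centerDir_ne_zero H) := by
  rw [semicircleCenter, dif_neg (centerDir_ne_zero H)]; rfl

theorem sq_norm_centerDir (g h : S2) : ‖centerDir g h‖ ^ 2 = 1 - ip g h ^ 2 := by
  have e : inner ℝ (h : EuclideanSpace ℝ (Fin 3)) (g : EuclideanSpace ℝ (Fin 3)) = ip g h :=
    real_inner_comm _ _
  rw [centerDir, norm_sub_sq_real, norm_smul, norm_coe, norm_coe, real_inner_smul_right, e,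
    Real.norm_eq_abs, mul_one, sq_abs]
  ring

theorem luneThickness_eq {g h : S2} (H : FormLune g h) :
    luneThickness g h = Real.arccos (-ip g h) := by
  have h1 := sq_norm_centerDir g h
  have h2 := sq_norm_centerDir h g
  rw [ip_comm h g] at h2
  have hp1 : 0 < ‖centerDir g h‖ := norm_pos_iff.mpr (centerDir_ne_zero H)
  have hp2 : 0 < ‖centerDir h g‖ := norm_pos_iff.mpr (centerDir_ne_zero H.symm)
  have heq : ‖centerDir g h‖ = ‖centerDir h g‖ := by
    rw [← sq_eq_sq₀ hp1.le hp2.le, h1, h2]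
  rw [luneThickness, sdist, coe_semicircleCenter H, coe_semicircleCenter H.symm, coe_direction,
    coe_direction, InnerProductGeometry.angle_smul_left_of_pos _ _ (inv_pos.mpr hp1),
    InnerProductGeometry.angle_smul_right_of_pos _ _ (inv_pos.mpr hp2), InnerProductGeometry.angle]
  congr 1
  rw [← heq, ← sq, h1, div_eq_iff (by rw [← h1]; positivity)]
  have e : inner ℝ (h : EuclideanSpace ℝ (Fin 3)) (g : EuclideanSpace ℝ (Fin 3)) = ip g h :=
    real_inner_comm _ _
  have e' : inner ℝ (g : EuclideanSpace ℝ (Fin 3)) (h : EuclideanSpace ℝ (Fin 3)) = ip g h := rfl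
  simp only [centerDir, inner_sub_left, inner_sub_right, real_inner_smul_left,
    real_inner_smul_right, inner_coe_self, e, e', ip_comm h g]
  ring

theorem IsFarthest.isStar {C : Set S2} (hC : IsConvexBody C) {k y : S2}
    (hk : (k : EuclideanSpace ℝ (Fin 3)) ∈ polar C) (h : IsFarthest C k y) : IsStar C k y := by
  refine ⟨h.supports hC hk, h.formLune hC hk, fun h' hs hl => ?_⟩
  rw [luneThickness_eq (h.formLune hC hk), luneThickness_eq hl]
  exact Real.arccos_le_arccos (neg_le_neg (h.2 h' hs.mem_polar))

theorem IsFarthest.width_eq {C : Set S2} (hC : IsConvexBody C) {k y : S2}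
    (hk : (k : EuclideanSpace ℝ (Fin 3)) ∈ polar C) (h : IsFarthest C k y) :
    width C k = Real.arccos (-ip k y) := by
  obtain ⟨h1, h2, h3⟩ := h.isStar hC hk
  rw [← luneThickness_eq h2]
  refine IsLeast.csInf_eq ⟨⟨y, h1, h2, rfl⟩, ?_⟩
  rintro t ⟨h', hs, hl, rfl⟩
  exact h3 h' hs hl

/-- Compactness yields two centers at the largest distance; each is farthest from the other, so both
hemispheres support C. -/
theorem IsConvexBody.exists_thickness_eq {C : Set S2} (hC : IsConvexBody C) :
    ∃ u v : S2, IsFarthest C u v ∧ IsFarthest C v u ∧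
      thickness C = Real.arccos (-ip u v) ∧ CosBound (polar C) (ip u v) := by
  obtain ⟨d, hd, -⟩ := hC.exists_mem_polar_ne hC.nonempty.some
  obtain ⟨⟨u, v⟩, ⟨hu, hv⟩, hmin⟩ := ((isCompact_polar C).prod (isCompact_polar C)).exists_isMinOn
    ⟨(d, d), hd, hd⟩ continuous_ip.continuousOn
  have hmin' : ∀ a b : S2, (a : EuclideanSpace ℝ (Fin 3)) ∈ polar C →
      (b : EuclideanSpace ℝ (Fin 3)) ∈ polar C → ip u v ≤ ip a b := fun a b ha hb =>
    hmin (show (a, b) ∈ _ from ⟨ha, hb⟩)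
  have huv : IsFarthest C u v := ⟨hv, fun h hh => hmin' u h hu hh⟩
  have hvu : IsFarthest C v u := ⟨hu, fun h hh => by rw [ip_comm v u]; exact hmin' v h hv hh⟩
  refine ⟨u, v, huv, hvu, ?_, ?_⟩
  · rw [← huv.width_eq hC hu]
    refine IsLeast.csInf_eq ⟨⟨u, hvu.supports hC hv, rfl⟩, ?_⟩
    rintro t ⟨k, hk, rfl⟩
    obtain ⟨y, hy⟩ := hC.exists_isFarthest k
    rw [huv.width_eq hC hu, hy.width_eq hC hk.mem_polar]
    exact Real.arccos_le_arccos (neg_le_neg (hmin' k y hk.mem_polar hy.1))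
  · intro a ha b hb
    by_cases ha0 : a = 0
    · simp [ha0]
    by_cases hb0 : b = 0
    · simp [hb0]
    have h := hmin' _ _ (direction_mem_polar ha0 ha) (direction_mem_polar hb0 hb)
    have e : ⟪a, b⟫ = ‖a‖ * ‖b‖ * ip (direction a ha0) (direction b hb0) := by
      conv_lhs => rw [← norm_smul_direction ha0, ← norm_smul_direction hb0]
      rw [real_inner_smul_left, real_inner_smul_right, ip]; ring
    rw [e, mul_comm]
    exact mul_le_mul_of_nonneg_left h (by positivity)

end

end Sph

/-! ### Reduced bodies have limit pairs -/

namespace Sph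

open Filter Topology

theorem IsConvexBody.cut {R : Set S2} (hR : IsConvexBody R) {q : EuclideanSpace ℝ (Fin 3)} {o : S2}
    (ho : o ∈ interior R) (hq : 0 < ⟪q, (o : EuclideanSpace ℝ (Fin 3))⟫) :
    IsConvexBody {x ∈ R | 0 ≤ ⟪q, (x : EuclideanSpace ℝ (Fin 3))⟫} where
  isClosed := by
    have h : IsClosed {x : S2 | 0 ≤ ⟪q, (x : EuclideanSpace ℝ (Fin 3))⟫} :=
      isClosed_le continuous_const (continuous_const.inner continuous_subtype_val)
    exact hR.isClosed.inter h
  isConvex := by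
    refine ⟨fun x hx hx' => hR.isConvex.1 x hx.1 hx'.1, ?_⟩
    rintro a ⟨ha, ha'⟩ b ⟨hb, hb'⟩ x hx
    refine ⟨hR.isConvex.2 a ha b hb hx, ?_⟩
    obtain ⟨s, t, hs, ht, e⟩ := hx
    rw [e, inner_add_right, real_inner_smul_right, real_inner_smul_right]
    positivity
  interior_nonempty := by
    have hopen : IsOpen {x : S2 | 0 < ⟪q, (x : EuclideanSpace ℝ (Fin 3))⟫} :=
      isOpen_lt continuous_const (continuous_const.inner continuous_subtype_val)
    refine ⟨o, mem_interior.mpr ⟨interior R ∩ {x : S2 | 0 < ⟪q, (x : EuclideanSpace ℝ (Fin 3))⟫},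
      ?_, isOpen_interior.inter hopen, ho, hq⟩⟩
    exact fun x hx => ⟨interior_subset hx.1, hx.2.le⟩

/-- Cutting a reduced body by a hemisphere gives a pair of hemispheres farther apart than all
pairs of hemispheres containing the body. -/
theorem IsReduced.exists_far_pair {R : Set S2} (hR : IsReduced R) {c : ℝ}
    (hc : thickness R = Real.arccos (-c)) (hb : CosBound (polar R) c)
    {q : EuclideanSpace ℝ (Fin 3)} {o : S2} (ho : o ∈ interior R)
    (hqo : 0 < ⟪q, (o : EuclideanSpace ℝ (Fin 3))⟫) (hq : q ∉ polar R) :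
    ∃ u v : S2, (∀ x ∈ R, 0 ≤ ⟪q, (x : EuclideanSpace ℝ (Fin 3))⟫ →
        0 ≤ ⟪(u : EuclideanSpace ℝ (Fin 3)), (x : EuclideanSpace ℝ (Fin 3))⟫ ∧
        0 ≤ ⟪(v : EuclideanSpace ℝ (Fin 3)), (x : EuclideanSpace ℝ (Fin 3))⟫) ∧
      ip u v < c ∧
      (∀ d ∈ polar R, 0 ≤ ⟪(v : EuclideanSpace ℝ (Fin 3)) - ip u v •
        (u : EuclideanSpace ℝ (Fin 3)), d⟫) ∧
      ⟪(v : EuclideanSpace ℝ (Fin 3)) - ip u v • (u : EuclideanSpace ℝ (Fin 3)), q⟫ = 0 := by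
  set Z : Set S2 := {x ∈ R | 0 ≤ ⟪q, (x : EuclideanSpace ℝ (Fin 3))⟫} with hZ
  have hZc : IsConvexBody Z := hR.1.cut ho hqo
  have hZR : Z ⊆ R := fun x hx => hx.1
  have hne : Z ≠ R := fun e => hq (mem_polar.mpr fun x hx => by rw [← e] at hx; exact hx.2)
  have hsub : ∀ d ∈ polar R, d ∈ polar Z := fun d hd =>
    mem_polar.mpr fun x hx => mem_polar.mp hd x (hZR hx)
  have hlt := hR.2 Z hZc hZR hne
  obtain ⟨u₀, v₀, huv₀, hvu₀, ht, -⟩ := hZc.exists_thickness_eq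
  have hlt' : ip u₀ v₀ < c := by
    by_contra hn
    push Not at hn
    rw [ht, hc] at hlt
    exact absurd hlt (not_lt.mpr (Real.arccos_le_arccos (neg_le_neg hn)))
  -- The two centers are not both in `polar R`, by the bound c. They are named so that u is outside
  -- it.
  obtain ⟨u, v, huv, hvu, hltc, hu⟩ : ∃ u v : S2, IsFarthest Z u v ∧ IsFarthest Z v u ∧
      ip u v < c ∧ (u : EuclideanSpace ℝ (Fin 3)) ∉ polar R := by
    by_cases hu : (u₀ : EuclideanSpace ℝ (Fin 3)) ∈ polar R
    · refine ⟨v₀, u₀, hvu₀, huv₀, by rwa [ip_comm], fun hv => ?_⟩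
      have := hb _ hu _ hv
      rw [norm_coe, norm_coe, mul_one, mul_one] at this
      exact absurd hlt' (not_lt.mpr this)
    · exact ⟨u₀, v₀, huv₀, hvu₀, hlt', hu⟩
  have hw : ∀ d ∈ polar Z, 0 ≤ ⟪(v : EuclideanSpace ℝ (Fin 3)) - ip u v •
      (u : EuclideanSpace ℝ (Fin 3)), d⟫ := fun d hd => by
    rw [ip_comm u v]
    exact inner_sub_smul_nonneg (fun d hd => hvu.le_inner hd) hvu.1 (norm_coe u) rfl hd
  set w : EuclideanSpace ℝ (Fin 3) := (v : EuclideanSpace ℝ (Fin 3)) - ip u v •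
      (u : EuclideanSpace ℝ (Fin 3)) with hwdef
  have hwu : ⟪(u : EuclideanSpace ℝ (Fin 3)), w⟫ = 0 := by
    rw [hwdef, inner_sub_right, real_inner_smul_right, inner_coe_self, ip]; ring
  have hqZ : q ∈ polar Z := mem_polar.mpr fun x hx => hx.2
  refine ⟨u, v, fun x hx hqx => ⟨mem_polar.mp hvu.1 x ⟨hx, hqx⟩, mem_polar.mp huv.1 x ⟨hx, hqx⟩⟩,
    hltc, fun d hd => hw d (hsub d hd), le_antisymm ?_ (hw q hqZ)⟩
  -- If ⟪w, q⟫ > 0, the direction x of w is a point of R inside the cut and orthogonal to u. A small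
  -- step towards a point r of R with ⟪u, r⟫ < 0 stays in Z but leaves the hemisphere of u; η is
  -- small enough for the cut to hold.
  by_contra hpos
  push Not at hpos
  obtain ⟨x, hx, ex⟩ := hR.1.exists_of_nonneg fun d hd => hw d (hsub d hd)
  obtain ⟨r, hr, hur⟩ : ∃ r ∈ R,
      ⟪(u : EuclideanSpace ℝ (Fin 3)), (r : EuclideanSpace ℝ (Fin 3))⟫ < 0 := by
    by_contra! hall
    exact hu (mem_polar.mpr hall)
  set η : ℝ := ⟪w, q⟫ / (|⟪q, (r : EuclideanSpace ℝ (Fin 3))⟫| + 1) with hη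
  have hden : 0 < |⟪q, (r : EuclideanSpace ℝ (Fin 3))⟫| + 1 := by positivity
  have hη0 : 0 < η := div_pos hpos hden
  have hηr : 0 ≤ ⟪w, q⟫ + η * ⟪q, (r : EuclideanSpace ℝ (Fin 3))⟫ := by
    have h1 : η * (|⟪q, (r : EuclideanSpace ℝ (Fin 3))⟫| + 1) = ⟪w, q⟫ := by
      rw [hη]; field_simp
    have h2 := neg_abs_le ⟪q, (r : EuclideanSpace ℝ (Fin 3))⟫
    nlinarith
  obtain ⟨y, hy, ey⟩ := hR.1.isConvex.combination hx hr (norm_nonneg w) hη0.le rfl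
  rw [← ex] at ey
  have hy0 : 0 < ‖w + η • (r : EuclideanSpace ℝ (Fin 3))‖ := by
    rw [norm_pos_iff]
    intro h0
    have := congrArg (fun z => ⟪(u : EuclideanSpace ℝ (Fin 3)), z⟫) h0
    simp only [inner_add_right, real_inner_smul_right, hwu, inner_zero_right] at this
    have := mul_neg_of_pos_of_neg hη0 hur
    linarith
  have hqy : 0 ≤ ⟪q, (y : EuclideanSpace ℝ (Fin 3))⟫ := by
    have h1 : ⟪q, w + η • (r : EuclideanSpace ℝ (Fin 3))⟫ =
        ⟪w, q⟫ + η * ⟪q, (r : EuclideanSpace ℝ (Fin 3))⟫ := by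
      rw [inner_add_right, real_inner_smul_right, real_inner_comm]
    rw [ey, real_inner_smul_right] at h1
    exact nonneg_of_mul_nonneg_right (by rw [h1]; exact hηr) hy0
  have huy := mul_nonneg hy0.le (mem_polar.mp hvu.1 y ⟨hy, hqy⟩)
  rw [← real_inner_smul_right, ← ey, inner_add_right, real_inner_smul_right, hwu] at huy
  have := mul_neg_of_pos_of_neg hη0 hur
  linarith

theorem IsReduced.hasLimitPairs {R : Set S2} (hR : IsReduced R) {c : ℝ}
    (hc : thickness R = Real.arccos (-c)) (hb : CosBound (polar R) c) :
    HasLimitPairs (polar R) c := by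
  intro z hz hz0 e e₀ ε he hε hε0 hout
  obtain ⟨o, ho⟩ := hR.1.interior_nonempty
  have hzo := inner_pos_of_mem_interior ho hz hz0
  have hq : Tendsto (fun n => z + ε n • e n) atTop (𝓝 z) := by
    have := (tendsto_const_nhds (x := z)).add (hε.smul he)
    simpa using this
  have hqi : ∀ y : EuclideanSpace ℝ (Fin 3), 0 < ⟪z, y⟫ →
      ∀ᶠ n in atTop, 0 < ⟪z + ε n • e n, y⟫ := fun y hy =>
    (hq.inner tendsto_const_nhds).eventually (lt_mem_nhds hy)
  -- From index N on, the interior point o remains strictly inside the cut, so the cut body has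
  -- interior.
  obtain ⟨N, hN⟩ := eventually_atTop.mp (hqi _ hzo)
  choose u v huv hlt hw hwq using fun n => hR.exists_far_pair hc hb ho (hN (n + N) (by omega))
    (hout (n + N))
  obtain ⟨⟨a, b⟩, φ, hφ, hlim⟩ := CompactSpace.tendsto_subseq fun n => (u n, v n)
  have hshift : Tendsto (fun n => φ n + N) atTop atTop :=
    (tendsto_add_atTop_nat N).comp hφ.tendsto_atTop
  have ha : Tendsto (fun n => (u (φ n) : EuclideanSpace ℝ (Fin 3))) atTop
      (𝓝 (a : EuclideanSpace ℝ (Fin 3))) :=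
    ((continuous_subtype_val.comp continuous_fst).tendsto (a, b)).comp hlim
  have hb' : Tendsto (fun n => (v (φ n) : EuclideanSpace ℝ (Fin 3))) atTop
      (𝓝 (b : EuclideanSpace ℝ (Fin 3))) :=
    ((continuous_subtype_val.comp continuous_snd).tendsto (a, b)).comp hlim
  have hip : Tendsto (fun n => ip (u (φ n)) (v (φ n))) atTop (𝓝 (ip a b)) := ha.inner hb'
  have hlimK : ∀ (p : ℕ → S2) (p₀ : S2),
      Tendsto (fun n => (p (φ n) : EuclideanSpace ℝ (Fin 3))) atTop
        (𝓝 (p₀ : EuclideanSpace ℝ (Fin 3))) →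
      (∀ n, ∀ x ∈ R, 0 ≤ ⟪z + ε (n + N) • e (n + N), (x : EuclideanSpace ℝ (Fin 3))⟫ →
        0 ≤ ⟪(p n : EuclideanSpace ℝ (Fin 3)), (x : EuclideanSpace ℝ (Fin 3))⟫) →
      (p₀ : EuclideanSpace ℝ (Fin 3)) ∈ polar R := by
    intro p p₀ hp hpos
    rw [mem_polar]
    intro x hx
    -- The point x may be cut off for every n, for instance when ⟪z, x⟫ = 0. Shifting it towards o
    -- makes its product with z positive, so it eventually survives; then η tends to 0.
    have key : ∀ η : ℝ, 0 < η → 0 ≤ ⟪(p₀ : EuclideanSpace ℝ (Fin 3)),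
        (x : EuclideanSpace ℝ (Fin 3)) + η • (o : EuclideanSpace ℝ (Fin 3))⟫ := by
      intro η hη
      obtain ⟨y, hy, ey⟩ := hR.1.isConvex.combination hx (interior_subset ho) zero_le_one hη.le rfl
      rw [one_smul] at ey
      have hzy : 0 < ⟪z, (x : EuclideanSpace ℝ (Fin 3)) + η • (o : EuclideanSpace ℝ (Fin 3))⟫ := by
        rw [inner_add_right, real_inner_smul_right]
        have := mem_polar.mp hz x hx
        positivity
      refine ge_of_tendsto (hp.inner tendsto_const_nhds) ?_
      filter_upwards [hshift.eventually (hqi _ hzy)] with n hn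
      set V := (x : EuclideanSpace ℝ (Fin 3)) + η • (o : EuclideanSpace ℝ (Fin 3))
      rw [ey, real_inner_smul_right] at hn ⊢
      refine mul_nonneg (norm_nonneg _) (hpos _ y hy ?_)
      by_contra hneg
      push Not at hneg
      exact absurd hn (not_lt.mpr (mul_nonpos_of_nonneg_of_nonpos (norm_nonneg _) hneg.le))
    by_contra hneg
    push Not at hneg
    have h1 := key (-⟪(p₀ : EuclideanSpace ℝ (Fin 3)), (x : EuclideanSpace ℝ (Fin 3))⟫ / 2)
      (by linarith)
    rw [inner_add_right, real_inner_smul_right] at h1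
    have h2 : ⟪(p₀ : EuclideanSpace ℝ (Fin 3)), (o : EuclideanSpace ℝ (Fin 3))⟫ ≤ 1 :=
      (abs_le.mp (abs_ip_le p₀ o)).2
    nlinarith
  have haK := hlimK u a ha fun n x hx h => (huv n x hx h).1
  have hbK := hlimK v b hb' fun n x hx h => (huv n x hx h).2
  have hab : ip a b = c := by
    refine le_antisymm (le_of_tendsto' hip fun n => (hlt (φ n)).le) ?_
    have := hb _ haK _ hbK
    rwa [norm_coe, norm_coe, mul_one, mul_one] at this
  have hwlim : Tendsto (fun n => (v (φ n) : EuclideanSpace ℝ (Fin 3)) -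
      ip (u (φ n)) (v (φ n)) • (u (φ n) : EuclideanSpace ℝ (Fin 3))) atTop
      (𝓝 ((b : EuclideanSpace ℝ (Fin 3)) - c • (a : EuclideanSpace ℝ (Fin 3)))) := by
    rw [← hab]
    exact hb'.sub (hip.smul ha)
  refine ⟨a, b, ⟨haK, hbK, norm_coe a, norm_coe b, hab⟩, ?_, ?_⟩
  · refine tendsto_nhds_unique (hwlim.inner (hq.comp hshift)) ?_
    refine tendsto_const_nhds.congr fun n => (hwq (φ n)).symm
  -- The normal vanishes at z + ε e and is nonnegative at z, so it is not positive at e.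
  · refine le_of_tendsto' (hwlim.inner (he.comp hshift)) fun n => ?_
    have h1 := hwq (φ n)
    rw [inner_add_right, real_inner_smul_right] at h1
    have h2 := hw (φ n) z hz
    by_contra hn
    push Not at hn
    have := mul_pos (hε0 (φ n + N)) hn
    simp only [Function.comp_apply] at this
    linarith

theorem isFrame_of_orthogonal {x₁ x₂ m : S2} (h1 : ip m x₁ = 0) (h2 : ip m x₂ = 0)
    (hg : ip x₁ x₂ ^ 2 < 1) :
    IsFrame (x₁ : EuclideanSpace ℝ (Fin 3)) (x₂ : EuclideanSpace ℝ (Fin 3))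
      (m : EuclideanSpace ℝ (Fin 3)) := by
  have h1' : ⟪(x₁ : EuclideanSpace ℝ (Fin 3)), (m : EuclideanSpace ℝ (Fin 3))⟫ = 0 := by
    rw [real_inner_comm]; exact h1
  have h2' : ⟪(x₂ : EuclideanSpace ℝ (Fin 3)), (m : EuclideanSpace ℝ (Fin 3))⟫ = 0 := by
    rw [real_inner_comm]; exact h2
  refine ⟨norm_coe m, h1', h2', fun a ha1 ha2 ham => ?_⟩
  have hli : LinearIndependent ℝ ![(x₁ : EuclideanSpace ℝ (Fin 3)),
      (x₂ : EuclideanSpace ℝ (Fin 3)), (m : EuclideanSpace ℝ (Fin 3))] := by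
    rw [Fintype.linearIndependent_iff]
    intro g hsum
    simp only [Fin.sum_univ_three, Matrix.cons_val_zero, Matrix.cons_val_one,
      Matrix.cons_val] at hsum
    have e1 := congrArg (fun y => ⟪(x₁ : EuclideanSpace ℝ (Fin 3)), y⟫) hsum
    have e2 := congrArg (fun y => ⟪(x₂ : EuclideanSpace ℝ (Fin 3)), y⟫) hsum
    have e3 := congrArg (fun y => ⟪(m : EuclideanSpace ℝ (Fin 3)), y⟫) hsum
    have f12 : ⟪(x₁ : EuclideanSpace ℝ (Fin 3)), (x₂ : EuclideanSpace ℝ (Fin 3))⟫ = ip x₁ x₂ := rfl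
    have f21 : ⟪(x₂ : EuclideanSpace ℝ (Fin 3)), (x₁ : EuclideanSpace ℝ (Fin 3))⟫ = ip x₁ x₂ :=
      real_inner_comm _ _
    have f31 : ⟪(m : EuclideanSpace ℝ (Fin 3)), (x₁ : EuclideanSpace ℝ (Fin 3))⟫ = 0 := h1
    have f32 : ⟪(m : EuclideanSpace ℝ (Fin 3)), (x₂ : EuclideanSpace ℝ (Fin 3))⟫ = 0 := h2
    simp only [inner_add_right, real_inner_smul_right, inner_coe_self, h1', h2', f12, f21, f31,
      f32, inner_zero_right] at e1 e2 e3
    have hpos : 0 < 1 - ip x₁ x₂ ^ 2 := by linarith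
    have g0 : g 0 * (1 - ip x₁ x₂ ^ 2) = 0 := by linear_combination e1 - ip x₁ x₂ * e2
    have g1 : g 1 * (1 - ip x₁ x₂ ^ 2) = 0 := by linear_combination e2 - ip x₁ x₂ * e1
    intro i
    fin_cases i
    · exact (mul_eq_zero.mp g0).resolve_right hpos.ne'
    · exact (mul_eq_zero.mp g1).resolve_right hpos.ne'
    · simpa using e3
  have hspan := hli.span_eq_top_of_card_eq_finrank (by simp)
  have hmem : a ∈ Submodule.span ℝ (Set.range ![(x₁ : EuclideanSpace ℝ (Fin 3)),
      (x₂ : EuclideanSpace ℝ (Fin 3)), (m : EuclideanSpace ℝ (Fin 3))]) := by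
    rw [hspan]; trivial
  rw [← inner_self_eq_zero (𝕜 := ℝ)]
  refine Submodule.span_induction (p := fun y _ => ⟪y, a⟫ = 0) ?_ ?_ ?_ ?_ hmem
  · rintro y ⟨i, rfl⟩
    fin_cases i
    · exact ha1
    · exact ha2
    · exact ham
  · simp
  · intro x y _ _ hx hy
    rw [inner_add_left, hx, hy, add_zero]
  · intro t x _ hx
    rw [real_inner_smul_left, hx, mul_zero]

end Sph

/-! ### The theorem -/

theorem theorem2 (R : Set S2) (hR : IsReduced R) (hΔ : thickness R < Real.pi / 2)
    (m : S2) (hm : Supports m R)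
    (x₁ x₂ : S2) (hne : x₁ ≠ x₂) (hanti : x₁ ≠ -x₂)
    (harc : greatCircle m ∩ frontier R = arc x₁ x₂) :
    width R m = thickness R ∧
      (∃ m' : S2, IsStar R m m') ∧
      ∀ m' : S2, IsStar R m m' → semicircleCenter m m' ∈ arc x₁ x₂ := by
  obtain ⟨u, v, huv, hvu, ht, hb⟩ := hR.1.exists_thickness_eq
  set c := ip u v with hcdef
  have hc : c < 0 := by
    rw [ht, Real.arccos_lt_pi_div_two] at hΔ
    linarith
  have hc1 : -1 < c := by
    refine lt_of_le_of_ne (abs_le.mp (abs_ip_le u v)).1 fun h => ?_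
    have e := eq_neg_of_ip_eq_neg_one (x := u) (y := v) h.symm
    exact (huv.formLune hR.1 hvu.1).2 (by rw [e, neg_neg])
  have hmem : ∀ x ∈ arc x₁ x₂, x ∈ R ∧ ip m x = 0 := by
    intro x hx
    rw [← harc] at hx
    exact ⟨hR.1.isClosed.frontier_subset hx.2, hx.1⟩
  have hx1 := hmem x₁ ⟨1, 0, zero_le_one, le_rfl, by simp⟩
  have hx2 := hmem x₂ ⟨0, 1, le_rfl, zero_le_one, by simp⟩
  have hg : ip x₁ x₂ ^ 2 < 1 := by
    rw [sq_lt_one_iff_abs_lt_one]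
    refine lt_of_le_of_ne (abs_ip_le x₁ x₂) fun h => ?_
    rcases (abs_eq zero_le_one).mp h with h | h
    · exact hne (eq_of_ip_eq_one h)
    · exact hanti (eq_neg_of_ip_eq_neg_one h)
  have hv : IsVertex (polar R) (x₁ : EuclideanSpace ℝ (Fin 3)) (x₂ : EuclideanSpace ℝ (Fin 3))
      (m : EuclideanSpace ℝ (Fin 3)) := by
    refine ⟨isFrame_of_orthogonal hx1.2 hx2.2 hg, hm.mem_polar, norm_coe _, norm_coe _, ?_, ?_, ?_⟩
    · intro d hd
      rw [real_inner_comm]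
      exact mem_polar.mp hd x₁ hx1.1
    · intro d hd
      rw [real_inner_comm]
      exact mem_polar.mp hd x₂ hx2.1
    · intro w hw hwm
      by_cases hw0 : w = 0
      · exact ⟨0, 0, le_rfl, le_rfl, by simp [hw0]⟩
      -- By the bipolar theorem a normal is a multiple of a point of R. Vanishing at m puts this
      -- point on the great circle of m, hence in the arc x₁x₂.
      obtain ⟨x, hx, e⟩ := hR.1.exists_of_nonneg hw
      have hmx : ip m x = 0 := by
        rw [e, real_inner_smul_left] at hwm
        have := (mul_eq_zero.mp hwm).resolve_left (norm_ne_zero_iff.mpr hw0)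
        rwa [real_inner_comm] at this
      have hxa : x ∈ arc x₁ x₂ := by
        rw [← harc]
        exact ⟨hmx, mem_frontier_of_ip_eq_zero hm.mem_polar hx hmx⟩
      obtain ⟨s, t, hs, ht, ex⟩ := hxa
      exact ⟨‖w‖ * s, ‖w‖ * t, by positivity, by positivity, by
        rw [mul_smul, mul_smul, ← smul_add, ← ex, ← e]⟩
  obtain ⟨n, hn⟩ := hv.exists_isPair hb hc1 hc hg (hR.hasLimitPairs ht hb)
  set m₀ : S2 := ⟨n, by rw [mem_sphere_zero_iff_norm]; exact hn.norm_right⟩ with hm₀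
  have hfar : IsFarthest R m m₀ := by
    refine ⟨hn.right_mem, fun h hh => ?_⟩
    have h1 := hb _ hm.mem_polar _ hh
    rw [norm_coe, norm_coe, mul_one, mul_one] at h1
    exact hn.inner_eq.trans_le h1
  have hstar := hfar.isStar hR.1 hm.mem_polar
  have hip : ip m m₀ = c := hn.inner_eq
  refine ⟨by rw [hfar.width_eq hR.1 hm.mem_polar, hip, ht], ⟨m₀, hstar⟩, fun m' hm' => ?_⟩
  have hm'K := hm'.1.mem_polar
  -- Every M* has the same minimal lune thickness as m₀, so it also forms a pair with m.
  have hmm' : ip m m' = c := by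
    have h1 := hm'.2.2 m₀ hstar.1 hstar.2.1
    rw [luneThickness_eq hm'.2.1, luneThickness_eq hstar.2.1, hip] at h1
    have h2 : c ≤ ip m m' := hip ▸ hfar.2 m' hm'K
    have b1 := abs_le.mp (abs_ip_le m m')
    refine le_antisymm ?_ h2
    by_contra hlt
    push Not at hlt
    exact absurd h1 (not_le.mpr (Real.arccos_lt_arccos (by linarith) (by linarith) (by linarith)))
  have hpair : IsPair (polar R) c (m : EuclideanSpace ℝ (Fin 3))
      (m' : EuclideanSpace ℝ (Fin 3)) :=
    ⟨hm.mem_polar, hm'K, norm_coe _, norm_coe _, hmm'⟩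
  -- The vector m' − c m is both a normal of the polar cone at m and the direction of the center of
  -- M/M*.
  obtain ⟨α, β, hα, hβ, e⟩ := hv.normal _ (fun d hd => hpair.normal_nonneg hb hd)
    hpair.inner_normal_left
  rw [coe_semicircleCenter hm'.2.1]
  exact direction_mem_arc hα hβ _ (by rw [centerDir, hmm', e])
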